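/- Let $n\ge 2$ and let $f(z,\bar z)=\sum_{\nu,\mu}c_{\nu,\mu}z^\nu\bar z^\mu$ be a mixed polynomial in $z=(z_1,\dots,z_n)$ (finitely many terms, $\nu,\mu\in\mathbb Z_{\ge0}^n$) with $f(0)=0$. *Newton polyhedron.* Let $\Gamma_+(f)$ be the convex hull of $\bigcup_{c_{\nu,\mu}\ne0}\big((\nu+\mu)+\mathbb R_{\ge0}^n\big)$. For a weight vector $P=(p_1,\dots,p_n)\in\mathbb R^n_{\ge0}\setminus\{0\}$ put $P(\xi)=\sum_i p_i\xi_i$, $d(P)=\min_{\Gamma_+(f)}P$ and $\Delta(P)=\{\xi\in\Gamma_+(f): P(\xi)=d(P)\}$; these sets are the faces of $\Gamma_+(f)$. Write $P\gg0$ ($P$ is strictly positive) if all $p_i>0$. For a compact face $\Delta$ let $f_\Delta=\sum_{\nu+\mu\in\Delta}c_{\nu,\mu}z^\nu\bar z^\mu$. For $I\subset\{1,\dots,n\}$ let $f^I$ be the restriction of $f$ to $\{z: z_j=0 \text{ for } j\notin I\}$. Assume that * $f$ is convenient: $f^I\not\equiv0$ for every $I\ne\emptyset$; * $f$ is Newton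 non-degenerate: for every compact face $\Delta$, at every zero of $f_\Delta$ in $(\mathbb C^*)^n$ the real differential of $f_\Delta:(\mathbb C^*)^n\to\mathbb C$ has rank $2$; * $f$ is of strongly polar non-negative mixed weighted homogeneous face type: for every compact face $\Delta$ there are $P\gg0$ with $\Delta=\Delta(P)$, an integer $d_r>0$ and an integer $d_p\ge0$ such that $P(\nu+\mu)=d_r$ and $P(\nu-\mu)=d_p$ for all monomials of $f_\Delta$. *Subdivision and toric modification.* Let $\Sigma^*$ be a regular simplicial cone subdivision of $\mathbb R^n_{\ge0}$: a finite set of cones, each generated by a part of a $\mathbb Z$-basis of $\mathbb Z^n$ (its generators are called its vertices), closed under taking faces, any two meeting in a common face, with union $\mathbb R^n_{\ge0}$. Assume that $\Sigma^*$ is admissible for $f$ ($P\mapsto\Delta(P)$ is constant on the relative interior of each non-zero cone) and convenient (for every $I$ with $f^I\not\equiv0$, the cone generated by the unit vectors $E_i$, $i\notin I$, belongs to $\Sigma^*$). Let $\hat\pi:X\to\mathbb C^n$ be the associated toric modification: $X$ is glued from copies $\mathbb C^n_\sigma$ of $\mathbb C^n$, one for each $n$-dimensional cone $\sigma=\mathrm{Cone}(P_1,\dots,P_n)$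 of $\Sigma^*$, along the monomial maps $\pi_{\tau^{-1}\sigma}$ wherever they are defined, and on $\mathbb C^n_\sigma$ the map $\hat\pi$ is $\pi_\sigma(u)=\big(\prod_j u_j^{p_{ij}}\big)_{i}$, where $P_j=(p_{1j},\dots,p_{nj})$. For a vertex $P$ of $\Sigma^*$ let $\hat E(P)\subset X$ be the divisor given by $u_j=0$ in the charts $\mathbb C^n_\sigma$ with $P=P_j$ a vertex of $\sigma$ (it does not meet the other charts). For a cone $\tau=\mathrm{Cone}(P_1,\dots,P_k)$ of $\Sigma^*$ put $$\hat E(\tau)^*=\bigcap_{i=1}^k\hat E(P_i)\setminus\bigcup_{Q\ \text{vertex of }\Sigma^*,\ Q\notin\{P_1,\dots,P_k\}}\hat E(Q).$$ Let $V=f^{-1}(0)$, let $\tilde V$ be the closure of $\hat\pi^{-1}(V\setminus\{0\})$ in $X$, and put $\tilde V(\tau)^*=\tilde V\cap\hat E(\tau)^*$. *The number $\Lambda$.* For a cone $\tau=\mathrm{Cone}(P_1,\dots,P_k)$ of $\Sigma^*$ with all $P_j\gg0$ let $$\Lambda(\tau)=\min\{P_j(\nu+\mu)-d(P_j)\;:\;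 c_{\nu,\mu}\ne0,\ 1\le j\le k,\ \nu+\mu\notin\Delta(P_j)\}$$ if this set is non-empty. Let $L(\Sigma^*)$ be the set of the numbers $\Lambda(\tau)$ over those cones $\tau$ with all vertices strictly positive for which that set is non-empty and $\tilde V(\tau)^*\cap\mathbb C^n_\sigma\neq\emptyset$ for some $n$-dimensional $\sigma\in\Sigma^*$ having $\tau$ as a face. **Theorem.** Manifolds are understood as embedded submanifolds of the given class of $X$ (for class $C^0$: locally flat topological submanifolds). (i) For every cone $\tau\in\Sigma^*$ of dimension $k\ge1$ whose vertices are all strictly positive, $\tilde V(\tau)^*$ is empty or a real analytic manifold of dimension $2(n-k-1)$ (in particular it is empty if $k=n$). (ii) Suppose that Assumption $(*)$ holds: for every point $x\in\tilde V\cap\hat\pi^{-1}(0)$ there is an $n$-dimensional cone $\sigma\in\Sigma^*$ such that $x\in\mathbb C^n_\sigma$, at least one toric coordinate of $x$ in $\mathbb C^n_\sigma$ vanishes, and all vertices of $\sigma$ that correspond to vanishing coordinates of $x$ are strictly positive. Then there is an open neighbourhood $U$ of $\tilde V\cap\hat\pi^{-1}(0)$ in $X$ such that: * if $L(\Sigma^*)\ne\emptyset$,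 then $\Lambda=\min L(\Sigma^*)$ exists and is an integer $\ge1$, and $\tilde V\cap U$ is a $C^{\Lambda-1}$-manifold of dimension $2(n-1)$; * if $L(\Sigma^*)=\emptyset$, then $\tilde V\cap U$ is a real analytic manifold of dimension $2(n-1)$; * hence in both cases $\tilde V\cap U$ is a topological manifold of dimension $2(n-1)$; * $(\tilde V\cap U)\setminus\hat\pi^{-1}(0)$ is a real analytic manifold of dimension $2(n-1)$. -/

import Mathlib

open scoped ContDiff

namespace MixedToric

/-! ### Mixed polynomials and Newton polyhedra -/

/-- A mixed polynomial `∑ c_{ν,μ} z^ν z̄^μ` in `n` complex variables, given by its coefficients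
`(ν, μ) ↦ c_{ν,μ}`, of which only finitely many are non-zero. -/
abbrev MixedPoly (n : ℕ) : Type := ((Fin n → ℕ) × (Fin n → ℕ)) →₀ ℂ

/-- The value `f(z, z̄)`. -/
noncomputable def MixedPoly.eval {n : ℕ} (f : MixedPoly n) (z : Fin n → ℂ) : ℂ :=
  f.sum fun m c => c * ((∏ i, z i ^ m.1 i) * ∏ i, (starRingEnd ℂ) (z i) ^ m.2 i)

/-- The radial exponent `ν + μ ∈ ℝⁿ` of a monomial `z^ν z̄^μ`. -/
def radialExponent {n : ℕ} (m : (Fin n → ℕ) × (Fin n → ℕ)) : Fin n → ℝ :=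
  fun i => (m.1 i : ℝ) + (m.2 i : ℝ)

/-- The polar exponent `ν - μ ∈ ℝⁿ` of a monomial `z^ν z̄^μ`. -/
def polarExponent {n : ℕ} (m : (Fin n → ℕ) × (Fin n → ℕ)) : Fin n → ℝ :=
  fun i => (m.1 i : ℝ) - (m.2 i : ℝ)

/-- The radial Newton polyhedron `Γ₊(f)`: the convex hull of the union of the translated orthants
`(ν + μ) + ℝ₊ⁿ` over all `(ν, μ)` with `c_{ν,μ} ≠ 0`. -/
def newtonPolyhedron {n : ℕ} (f : MixedPoly n) : Set (Fin n → ℝ) :=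
  convexHull ℝ (⋃ m ∈ f.support, {ξ | ∀ i, radialExponent m i ≤ ξ i})

/-- The linear function `P(ξ) = ∑ pᵢ ξᵢ` of a weight vector `P`. -/
def weightPairing {n : ℕ} (P ξ : Fin n → ℝ) : ℝ := ∑ i, P i * ξ i

/-- Weight vectors: non-zero vectors with non-negative real entries. -/
def IsWeightVector {n : ℕ} (P : Fin n → ℝ) : Prop := (∀ i, 0 ≤ P i) ∧ P ≠ 0

/-- `d(P)`, the minimum of `P` on `Γ₊(f)`. -/
noncomputable def minValue {n : ℕ} (f : MixedPoly n) (P : Fin n → ℝ) : ℝ :=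
  sInf (weightPairing P '' newtonPolyhedron f)

/-- The face `Δ(P)` of `Γ₊(f)`, where `P` attains its minimum. -/
def face {n : ℕ} (f : MixedPoly n) (P : Fin n → ℝ) : Set (Fin n → ℝ) :=
  {ξ ∈ newtonPolyhedron f | weightPairing P ξ = minValue f P}

/-- `Δ` is a compact face of `Γ₊(f)`. -/
def IsCompactFace {n : ℕ} (f : MixedPoly n) (Δ : Set (Fin n → ℝ)) : Prop :=
  (∃ P, IsWeightVector P ∧ Δ = face f P) ∧ IsCompact Δ

open Classical in
/-- The face function `f_Δ`: the part of `f` consisting of the monomials with `ν + μ ∈ Δ`. -/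
noncomputable def faceFunction {n : ℕ} (f : MixedPoly n) (Δ : Set (Fin n → ℝ)) : MixedPoly n :=
  f.filter fun m => radialExponent m ∈ Δ

/-! ### Weighted homogeneity, non-degeneracy, convenience -/

/-- `g` is radially weighted homogeneous of radial degree `d` with respect to `P`. -/
def IsRadiallyHomogeneous {n : ℕ} (g : MixedPoly n) (P : Fin n → ℝ) (d : ℤ) : Prop :=
  ∀ m ∈ g.support, weightPairing P (radialExponent m) = d

/-- `g` is polar weighted homogeneous of polar degree `d` with respect to `P`. -/
def IsPolarHomogeneous {n : ℕ} (g : MixedPoly n) (P : Fin n → ℝ) (d : ℤ) : Prop :=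
  ∀ m ∈ g.support, weightPairing P (polarExponent m) = d

/-- `g` is a strongly polar non-negative mixed weighted homogeneous polynomial with respect to the
weight vector `P`: the same `P` serves for both homogeneities, the radial degree is a positive
integer and the polar degree is a non-negative integer. -/
def IsStronglyPolarNonneg {n : ℕ} (g : MixedPoly n) (P : Fin n → ℝ) : Prop :=
  (∃ dr : ℤ, 0 < dr ∧ IsRadiallyHomogeneous g P dr) ∧
    ∃ dp : ℤ, 0 ≤ dp ∧ IsPolarHomogeneous g P dp

/-- `f` is of strongly polar non-negative mixed weighted homogeneous face type. -/
def IsStronglyPolarNonnegFaceType {n : ℕ} (f : MixedPoly n) : Prop :=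
  ∀ Δ, IsCompactFace f Δ →
    ∃ P : Fin n → ℝ, (∀ i, 0 < P i) ∧ face f P = Δ ∧ IsStronglyPolarNonneg (faceFunction f Δ) P

/-- `f` is Newton non-degenerate: for every compact face `Δ`, the value `0` is not a mixed critical
value of `f_Δ : (ℂ*)ⁿ → ℂ`, i.e. the real differential of `f_Δ` has rank two at each zero. -/
def IsNewtonNondegenerate {n : ℕ} (f : MixedPoly n) : Prop :=
  ∀ Δ, IsCompactFace f Δ → ∀ z : Fin n → ℂ, (∀ i, z i ≠ 0) → (faceFunction f Δ).eval z = 0 →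
    Function.Surjective (fderiv ℝ (faceFunction f Δ).eval z)

/-- The restriction `f^I` of `f` to `ℂ^I = {z | z_j = 0 for j ∉ I}` is not identically zero. -/
def RestrictionNonzero {n : ℕ} (f : MixedPoly n) (I : Finset (Fin n)) : Prop :=
  ∃ z : Fin n → ℂ, (∀ j, j ∉ I → z j = 0) ∧ f.eval z ≠ 0

/-- `f` is convenient. -/
def IsConvenient {n : ℕ} (f : MixedPoly n) : Prop :=
  ∀ I : Finset (Fin n), I.Nonempty → RestrictionNonzero f I

/-! ### Regular simplicial cone subdivisions -/

/-- A non-negative integral vector, seen in `ℝⁿ`. -/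
def toReal {n : ℕ} (P : Fin n → ℕ) : Fin n → ℝ := fun i => (P i : ℝ)

/-- `Cone(P₁, …, P_k)` for `τ = {P₁, …, P_k}`. -/
def cone {n : ℕ} (τ : Finset (Fin n → ℕ)) : Set (Fin n → ℝ) :=
  {x | ∃ r : (Fin n → ℕ) → ℝ, (∀ P ∈ τ, 0 ≤ r P) ∧ x = ∑ P ∈ τ, r P • toReal P}

/-- The interior `{∑ r_j P_j | all r_j > 0}` of `Cone(P₁, …, P_k)`. -/
def coneInterior {n : ℕ} (τ : Finset (Fin n → ℕ)) : Set (Fin n → ℝ) :=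
  {x | ∃ r : (Fin n → ℕ) → ℝ, (∀ P ∈ τ, 0 < r P) ∧ x = ∑ P ∈ τ, r P • toReal P}

/-- A regular simplicial cone subdivision of `ℝ₊ⁿ`: a finite collection of cones, each generated
by a part of a `ℤ`-basis of `ℤⁿ`, closed under taking faces, any two of which intersect in a common
face, and which cover `ℝ₊ⁿ`. A cone is recorded by the finite set of its primitive generators (its
vertices); its dimension is the number of generators, and its faces are the cones generated by
subsets. -/
structure RegularSubdivision (n : ℕ) where
  cones : Finset (Finset (Fin n → ℕ))
  regular : ∀ τ ∈ cones, ∃ b : Module.Basis (Fin n) ℤ (Fin n → ℤ),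
    ∀ P ∈ τ, ∃ i, b i = fun j => (P j : ℤ)
  face_mem : ∀ τ ∈ cones, ∀ ρ ⊆ τ, ρ ∈ cones
  inter : ∀ σ ∈ cones, ∀ τ ∈ cones, cone σ ∩ cone τ = cone (σ ∩ τ)
  cover : ∀ x : Fin n → ℝ, (∀ i, 0 ≤ x i) → ∃ τ ∈ cones, x ∈ cone τ

/-- The vertices of the subdivision: the generators of its one-dimensional cones. -/
def RegularSubdivision.vertices {n : ℕ} (S : RegularSubdivision n) : Set (Fin n → ℕ) :=
  {P | {P} ∈ S.cones}

/-- `P ≫ 0`. -/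
def StrictlyPositive {n : ℕ} (P : Fin n → ℕ) : Prop := ∀ i, 0 < P i

/-- The subdivision is admissible for `f`: on the interior of each of its cones the face `Δ(P)` does
not depend on `P`, i.e. the interior lies in one equivalence class of the dual Newton diagram. -/
def RegularSubdivision.IsAdmissible {n : ℕ} (S : RegularSubdivision n) (f : MixedPoly n) : Prop :=
  ∀ τ ∈ S.cones, ∀ P ∈ coneInterior τ, ∀ Q ∈ coneInterior τ, face f P = face f Q

/-- The generators `E_i`, `i ∈ J`, of the cone `E_J`. -/
def unitVectors {n : ℕ} (J : Finset (Fin n)) : Finset (Fin n → ℕ) :=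
  J.image fun i => Pi.single i 1

/-- The subdivision is convenient for `f`: it contains `E_{Iᶜ}` for each `I` with `f^I ≢ 0`. -/
def RegularSubdivision.IsConvenientFor {n : ℕ} (S : RegularSubdivision n) (f : MixedPoly n) :
    Prop :=
  ∀ I : Finset (Fin n), RestrictionNonzero f I → unitVectors Iᶜ ∈ S.cones

/-! ### The toric modification -/

/-- The `n`-dimensional cones of the subdivision. -/
abbrev RegularSubdivision.MaxCone {n : ℕ} (S : RegularSubdivision n) : Type :=
  {σ : Finset (Fin n → ℕ) // σ ∈ S.cones ∧ σ.card = n}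

/-- The affine space `ℂⁿ_σ`; its toric coordinates `u_P` are indexed by the vertices `P` of `σ`. -/
abbrev ChartSpace {n : ℕ} {S : RegularSubdivision n} (σ : S.MaxCone) : Type :=
  {P : Fin n → ℕ // P ∈ σ.1} → ℂ

/-- The toric morphism `π_σ : ℂⁿ_σ → ℂⁿ`, `z_i = ∏_{P ∈ σ} u_P ^ p_i`. -/
noncomputable def chartProj {n : ℕ} {S : RegularSubdivision n} (σ : S.MaxCone)
    (u : ChartSpace σ) : Fin n → ℂ :=
  fun i => ∏ P, u P ^ P.1 i

/-- The gluing of the affine spaces: `u ∈ ℂⁿ_σ` and `v ∈ ℂⁿ_τ` are identified if the monomial map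
`π_{τ⁻¹σ}` is defined at `u` and takes the value `v` there. Here `A = τ⁻¹σ` is the matrix
expressing the vertices of `σ` through those of `τ`, and the map is defined at `u` if no zero
coordinate of `u` carries a negative exponent. -/
def Glue {n : ℕ} (S : RegularSubdivision n) (p q : (σ : S.MaxCone) × ChartSpace σ) : Prop :=
  ∃ A : {Q : Fin n → ℕ // Q ∈ q.1.1} → {P : Fin n → ℕ // P ∈ p.1.1} → ℤ,
    (∀ P i, (P.1 i : ℤ) = ∑ Q, A Q P * (Q.1 i : ℤ)) ∧
    (∀ Q P, A Q P < 0 → p.2 P ≠ 0) ∧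
    ∀ Q, q.2 Q = ∏ P, p.2 P ^ A Q P

/-- The space `X` of the toric modification: the disjoint union of the `ℂⁿ_σ` over all
`n`-dimensional cones `σ`, glued along the monomial maps, with the quotient topology. -/
def ToricModification {n : ℕ} (S : RegularSubdivision n) : Type := Quot (Glue S)

instance {n : ℕ} (S : RegularSubdivision n) : TopologicalSpace (ToricModification S) :=
  inferInstanceAs (TopologicalSpace (Quot (Glue S)))

/-- The inclusion `ℂⁿ_σ → X` of a toric chart. -/
def chartIncl {n : ℕ} {S : RegularSubdivision n} (σ : S.MaxCone) (u : ChartSpace σ) :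
    ToricModification S :=
  Quot.mk (Glue S) ⟨σ, u⟩

theorem chartProj_eq_of_glue {n : ℕ} (S : RegularSubdivision n)
    (p q : (σ : S.MaxCone) × ChartSpace σ) (h : Glue S p q) :
    chartProj p.1 p.2 = chartProj q.1 q.2 := by
  obtain ⟨A, hA, hdef, hv⟩ := h
  funext i
  have key : ∀ P, p.2 P ^ P.1 i = ∏ Q, (p.2 P ^ A Q P) ^ Q.1 i := by
    intro P
    rw [← zpow_natCast, hA P i]
    by_cases h0 : p.2 P = 0
    · have hnn : ∀ Q, 0 ≤ A Q P := fun Q => by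
        by_contra hneg
        exact hdef Q P (not_le.mp hneg) h0
      choose B hB using fun Q => Int.eq_ofNat_of_zero_le (hnn Q)
      have : (∑ Q, A Q P * (Q.1 i : ℤ)) = ((∑ Q, B Q * Q.1 i : ℕ) : ℤ) := by
        push_cast
        exact Finset.sum_congr rfl fun Q _ => by rw [hB Q]
      rw [this, zpow_natCast, ← Finset.prod_pow_eq_pow_sum]
      exact Finset.prod_congr rfl fun Q _ => by rw [hB Q, zpow_natCast, pow_mul]
    · have hsum : ∀ s : Finset {Q : Fin n → ℕ // Q ∈ q.1.1},
          p.2 P ^ (∑ Q ∈ s, A Q P * (Q.1 i : ℤ)) = ∏ Q ∈ s, (p.2 P ^ A Q P) ^ Q.1 i := by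
        intro s
        induction s using Finset.cons_induction with
        | empty => simp
        | cons a s ha ih =>
          rw [Finset.sum_cons, Finset.prod_cons, zpow_add₀ h0, ih, zpow_mul, zpow_natCast]
      exact hsum Finset.univ
  calc chartProj p.1 p.2 i = ∏ P, ∏ Q, (p.2 P ^ A Q P) ^ Q.1 i :=
        Finset.prod_congr rfl fun P _ => key P
    _ = ∏ Q, ∏ P, (p.2 P ^ A Q P) ^ Q.1 i := Finset.prod_comm
    _ = chartProj q.1 q.2 i :=
        Finset.prod_congr rfl fun Q _ => by rw [Finset.prod_pow, hv Q]

/-- The toric modification `π̂ : X → ℂⁿ`, equal to `π_σ` on `ℂⁿ_σ`. -/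
noncomputable def toricProj {n : ℕ} (S : RegularSubdivision n) :
    ToricModification S → (Fin n → ℂ) :=
  Quot.lift (fun p => chartProj p.1 p.2) (chartProj_eq_of_glue S)

/-- The exceptional fibre `π̂⁻¹(0)`. -/
def exceptionalSet {n : ℕ} (S : RegularSubdivision n) : Set (ToricModification S) :=
  toricProj S ⁻¹' {0}

/-- The divisor `Ê(P)` of a vertex `P`: in the charts `ℂⁿ_σ` with `P ∈ σ` it is `{u_P = 0}`, and it
does not meet the other charts. -/
def divisor {n : ℕ} (S : RegularSubdivision n) (P : Fin n → ℕ) : Set (ToricModification S) :=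
  {x | ∃ (σ : S.MaxCone) (hP : P ∈ σ.1) (u : ChartSpace σ), u ⟨P, hP⟩ = 0 ∧ x = chartIncl σ u}

/-- `Ê(τ)* = (⋂_{P ∈ τ} Ê(P)) ∖ ⋃ {Ê(Q) | Q a vertex not in τ}`. -/
def divisorStratum {n : ℕ} (S : RegularSubdivision n) (τ : Finset (Fin n → ℕ)) :
    Set (ToricModification S) :=
  (⋂ P ∈ τ, divisor S P) \ ⋃ Q ∈ {Q | Q ∈ S.vertices ∧ Q ∉ τ}, divisor S Q

/-- The strict transform `Ṽ`: the closure of `π̂⁻¹(V ∖ {0})` in `X`, where `V = f⁻¹(0)`. -/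
def strictTransform {n : ℕ} (S : RegularSubdivision n) (f : MixedPoly n) :
    Set (ToricModification S) :=
  closure (toricProj S ⁻¹' ({z | f.eval z = 0} \ {0}))

/-- `Ṽ(τ)* = Ṽ ∩ Ê(τ)*`. -/
def strictTransformStratum {n : ℕ} (S : RegularSubdivision n) (f : MixedPoly n)
    (τ : Finset (Fin n → ℕ)) : Set (ToricModification S) :=
  strictTransform S f ∩ divisorStratum S τ

/-! ### Submanifolds -/

/-- `M` is an embedded `C^s`-submanifold of dimension `d` of the real vector space `E`: near each
of its points, a local `C^s`-diffeomorphism of `E` (a local homeomorphism if `s = 0`, a real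
analytic one if `s = ω`) carries `M` to a linear subspace of dimension `d`. -/
def IsSubmanifold {E : Type*} [NormedAddCommGroup E] [NormedSpace ℝ E] (s : WithTop ℕ∞) (d : ℕ)
    (M : Set E) : Prop :=
  ∀ x ∈ M, ∃ (φ : OpenPartialHomeomorph E E) (W : Submodule ℝ E),
    x ∈ φ.source ∧ ContDiffOn ℝ s φ φ.source ∧ ContDiffOn ℝ s φ.symm φ.target ∧
    Module.finrank ℝ W = d ∧ φ.IsImage M (W : Set E)

/-- `M` is a `C^s`-submanifold of dimension `d` of `X`: it is one in each of the toric charts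
`ℂⁿ_σ`, which form an open cover of `X` with analytic coordinate changes. -/
def IsToricSubmanifold {n : ℕ} {S : RegularSubdivision n} (s : WithTop ℕ∞) (d : ℕ)
    (M : Set (ToricModification S)) : Prop :=
  ∀ σ : S.MaxCone, IsSubmanifold s d (chartIncl σ ⁻¹' M)

/-! ### The number `Λ` and the assumption on the position of `Ṽ` -/

/-- The set of all `P(ν + μ) - d(P)` with `P` a vertex of `τ`, `c_{ν,μ} ≠ 0`, `ν + μ ∉ Δ(P)`. -/
def excessSet {n : ℕ} (f : MixedPoly n) (τ : Finset (Fin n → ℕ)) : Set ℝ :=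
  {x | ∃ P ∈ τ, ∃ m ∈ f.support, radialExponent m ∉ face f (toReal P) ∧
    x = weightPairing (toReal P) (radialExponent m) - minValue f (toReal P)}

/-- `Λ(τ)`, the minimum of the finite set `excessSet f τ` (used only when this is non-empty). -/
noncomputable def lambdaOfCone {n : ℕ} (f : MixedPoly n) (τ : Finset (Fin n → ℕ)) : ℝ :=
  sInf (excessSet f τ)

/-- The set `L(Σ*)` of all `Λ(τ)` such that all vertices of `τ` are strictly positive, the set
defining `Λ(τ)` is non-empty, and `Ṽ(τ)*` meets a chart `ℂⁿ_σ` with `τ` a face of `σ`. -/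
def lambdaSet {n : ℕ} (S : RegularSubdivision n) (f : MixedPoly n) : Set ℝ :=
  {x | ∃ τ ∈ S.cones, (∀ P ∈ τ, StrictlyPositive P) ∧ (excessSet f τ).Nonempty ∧
    (∃ σ : S.MaxCone, τ ⊆ σ.1 ∧
      (strictTransformStratum S f τ ∩ Set.range (chartIncl σ)).Nonempty) ∧
    x = lambdaOfCone f τ}

/-- Assumption (*): each point of `Ṽ ∩ π̂⁻¹(0)` lies in a toric chart `ℂⁿ_σ` in which at least one of
its coordinates vanishes and the vanishing coordinates all belong to strictly positive vertices. -/
def AssumptionStar {n : ℕ} (S : RegularSubdivision n) (f : MixedPoly n) : Prop :=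
  ∀ x ∈ strictTransform S f ∩ exceptionalSet S, ∃ (σ : S.MaxCone) (u : ChartSpace σ),
    x = chartIncl σ u ∧ (∃ P, u P = 0) ∧ ∀ P, u P = 0 → StrictlyPositive P.1

end MixedToric

open MixedToric

/-!
# Smoothness of the strict transform of a mixed hypersurface under a toric modification

**Polar homogeneity for every weight.** The face type hypothesis provides, for each compact face,
only *some* weight for which the face function is polar homogeneous. Convenience extends this to
every non-negative weight `P` (`polar_homogeneous_of_nonneg`): inside the normal cone of its face
`P` is a non-negative combination of weights given by the hypothesis and of a weight with a
vanishing coordinate, and for the latter the face monomials have polar degree zero. Therefore all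
monomials of `f` on `Δ(P)` acquire the same power `u_P ^ a * ū_P ^ b` in a toric chart.

**The quotient.** Let `τ` be a cone with strictly positive vertices. Dividing `f ∘ π_σ` by these
powers for all `P ∈ τ` gives a function `F` (`chartQuotient`) with the same zeros off the divisors.
It is the sum of an initial part, which comes from the face function of `⋂_{P ∈ τ} Δ(P)` and does
not depend on `u_τ`, and of terms containing a factor `u_P ^ α * ū_P ^ β` with
`α + β = P(ν + μ) - d(P) ≥ 1`. Such a factor is homogeneous of degree `α + β`, hence of class
`C^{α+β-1}` and no better in general (`contDiff_mixedPow`); this is the origin of `Λ - 1`.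
Non-degeneracy says that the initial part is a submersion at its zeros
(`isTransversal_chartQuotient`), and so `(u_τ, F)` is one as soon as `F` is differentiable.
Consequently the strict transform is `{F = 0}` near the stratum
(`eventually_mem_chartStrictTransform_iff`), and the implicit function theorem applies.

**The case `Λ = 1`.** Then `F` is merely continuous. The homeomorphism `w ↦ |w|² w` of the
coordinates in `τ` (`radialCube`, `cubeOn`) triples the degrees `α + β`, after which `F` is of class
`C¹`. This gives the topological submanifold, and also shows that `f` is a submersion at all
nearby zeros in the torus.

**Globalization.** Two points of toric charts are identified exactly if the same coordinates vanish
and the same Laurent monomials make sense and agree (`glue_iff`). Hence the gluing is an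
equivalence relation, the charts are open in `X`, the closure defining the strict transform can be
computed in each chart, and the strata are given by the vanishing coordinates. The neighbourhood `U`
is the complement of the closure of the set of points that either lie on a divisor of a vertex that
is not strictly positive or lie in the torus over a singular point of `f = 0`; this description is
independent of charts, so each chart can be treated on its own.
-/

namespace MixedToric

open scoped ContDiff Pointwise Topology ComplexConjugate

/-! ### Faces of the Newton polyhedron -/

theorem isLinearMap_weightPairing {n : ℕ} (P : Fin n → ℝ) : IsLinearMap ℝ (weightPairing P) where
  map_add x y := by simp [weightPairing, mul_add, Finset.sum_add_distrib]
  map_smul c x := by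
    simp only [weightPairing, Pi.smul_apply, smul_eq_mul, Finset.mul_sum]
    exact Finset.sum_congr rfl fun i _ => by ring

theorem weightPairing_sub_left {n : ℕ} (P Q ξ : Fin n → ℝ) (t : ℝ) :
    weightPairing (P - t • Q) ξ = weightPairing P ξ - t * weightPairing Q ξ := by
  simp only [weightPairing, Pi.sub_apply, Pi.smul_apply, smul_eq_mul, Finset.mul_sum,
    ← Finset.sum_sub_distrib]
  exact Finset.sum_congr rfl fun i _ => by ring

theorem radialExponent_mem_newtonPolyhedron {n : ℕ} {f : MixedPoly n}
    {m : (Fin n → ℕ) × (Fin n → ℕ)} (hm : m ∈ f.support) :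
    radialExponent m ∈ newtonPolyhedron f :=
  subset_convexHull ℝ _ (Set.mem_biUnion hm fun _ => le_rfl)

/-- On the Newton polyhedron a non-negative weight is bounded below by its values at the
monomials. -/
theorem le_weightPairing_of_mem {n : ℕ} {f : MixedPoly n} {P : Fin n → ℝ} (hP : ∀ i, 0 ≤ P i)
    {d : ℝ} (hd : ∀ m ∈ f.support, d ≤ weightPairing P (radialExponent m)) {ξ : Fin n → ℝ}
    (hξ : ξ ∈ newtonPolyhedron f) : d ≤ weightPairing P ξ := by
  have hconv : Convex ℝ {ξ | d ≤ weightPairing P ξ} :=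
    convex_halfSpace_ge (isLinearMap_weightPairing P) d
  refine convexHull_min ?_ hconv hξ
  intro η hη
  obtain ⟨m, hm, hmη⟩ := Set.mem_iUnion₂.1 hη
  exact (hd m hm).trans (Finset.sum_le_sum fun i _ => mul_le_mul_of_nonneg_left (hmη i) (hP i))

/-- If a non-negative weight is minimal among the monomials at `m₀`, then `d(P)` is its value
at `m₀`. -/
theorem minValue_eq {n : ℕ} {f : MixedPoly n} {P : Fin n → ℝ} (hP : ∀ i, 0 ≤ P i)
    {m₀ : (Fin n → ℕ) × (Fin n → ℕ)} (hm₀ : m₀ ∈ f.support)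
    (hmin : ∀ m ∈ f.support,
      weightPairing P (radialExponent m₀) ≤ weightPairing P (radialExponent m)) :
    minValue f P = weightPairing P (radialExponent m₀) := by
  refine IsLeast.csInf_eq ⟨⟨_, radialExponent_mem_newtonPolyhedron hm₀, rfl⟩, ?_⟩
  rintro _ ⟨ξ, hξ, rfl⟩
  exact le_weightPairing_of_mem hP hmin hξ

theorem exists_minValue_eq {n : ℕ} {f : MixedPoly n} (hf : f.support.Nonempty) {P : Fin n → ℝ}
    (hP : ∀ i, 0 ≤ P i) :
    ∃ m₀ ∈ f.support, minValue f P = weightPairing P (radialExponent m₀) := by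
  obtain ⟨m₀, hm₀, hmin⟩ :=
    Finset.exists_min_image f.support (fun m => weightPairing P (radialExponent m)) hf
  exact ⟨m₀, hm₀, minValue_eq hP hm₀ hmin⟩

theorem minValue_le {n : ℕ} {f : MixedPoly n} {P : Fin n → ℝ} (hP : ∀ i, 0 ≤ P i)
    {m : (Fin n → ℕ) × (Fin n → ℕ)} (hm : m ∈ f.support) :
    minValue f P ≤ weightPairing P (radialExponent m) := by
  obtain ⟨m₀, hm₀, hmin⟩ :=
    Finset.exists_min_image f.support (fun m => weightPairing P (radialExponent m)) ⟨m, hm⟩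
  rw [minValue_eq hP hm₀ hmin]
  exact hmin m hm

theorem radialExponent_mem_face {n : ℕ} {f : MixedPoly n} {P : Fin n → ℝ}
    {m : (Fin n → ℕ) × (Fin n → ℕ)} (hm : m ∈ f.support) :
    radialExponent m ∈ face f P ↔ weightPairing P (radialExponent m) = minValue f P :=
  ⟨fun h => h.2, fun h => ⟨radialExponent_mem_newtonPolyhedron hm, h⟩⟩

/-- `Γ₊(f)` is the sum of a polytope and the closed orthant. -/
theorem isClosed_newtonPolyhedron {n : ℕ} (f : MixedPoly n) : IsClosed (newtonPolyhedron f) := by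
  have hO : Convex ℝ {ξ : Fin n → ℝ | ∀ i, 0 ≤ ξ i} := by
    intro x hx y hy a b ha hb _ i
    exact add_nonneg (mul_nonneg ha (hx i)) (mul_nonneg hb (hy i))
  have hEq : (⋃ m ∈ f.support, {ξ : Fin n → ℝ | ∀ i, radialExponent m i ≤ ξ i}) =
      radialExponent '' (f.support : Set ((Fin n → ℕ) × (Fin n → ℕ))) +
        {ξ : Fin n → ℝ | ∀ i, 0 ≤ ξ i} := by
    ext ξ
    simp only [Set.mem_iUnion, Set.mem_ofPred_eq, Set.mem_add, Set.mem_image, exists_prop]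
    constructor
    · rintro ⟨m, hm, h⟩
      exact ⟨_, ⟨m, hm, rfl⟩, ξ - radialExponent m, fun i => sub_nonneg.2 (h i), by simp⟩
    · rintro ⟨_, ⟨m, hm, rfl⟩, η, hη, rfl⟩
      exact ⟨m, hm, fun i => le_add_of_nonneg_right (hη i)⟩
  rw [newtonPolyhedron, hEq, convexHull_add, hO.convexHull_eq]
  have hfin : (radialExponent '' (f.support : Set ((Fin n → ℕ) × (Fin n → ℕ)))).Finite :=
    f.support.finite_toSet.image _
  have hc : IsClosed {ξ : Fin n → ℝ | ∀ i, 0 ≤ ξ i} := by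
    simp only [Set.ofPred_forall]
    exact isClosed_iInter fun i => isClosed_le continuous_const (continuous_apply i)
  exact hc.add_left_of_isCompact (hfin.isCompact_convexHull ℝ)

theorem nonneg_of_mem_newtonPolyhedron {n : ℕ} {f : MixedPoly n} {ξ : Fin n → ℝ}
    (hξ : ξ ∈ newtonPolyhedron f) (i : Fin n) : 0 ≤ ξ i := by
  have := le_weightPairing_of_mem (P := Pi.single i 1) (d := 0)
    (fun j => by by_cases h : j = i <;> simp [h])
    (fun m _ => Finset.sum_nonneg fun j _ => mul_nonneg
      (by by_cases h : j = i <;> simp [h])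
      (by unfold radialExponent; positivity)) hξ
  simpa [weightPairing, Pi.single_apply] using this

/-- The face of a strictly positive weight is compact. -/
theorem isCompactFace_face {n : ℕ} (hn : n ≠ 0) (f : MixedPoly n) {P : Fin n → ℝ}
    (hP : ∀ i, 0 < P i) : IsCompactFace f (face f P) := by
  have hne : P ≠ 0 := fun h => (hP ⟨0, Nat.pos_of_ne_zero hn⟩).ne' (by simp [h])
  refine ⟨⟨P, ⟨fun i => (hP i).le, hne⟩, rfl⟩, ?_⟩
  have hcont : Continuous (weightPairing P) := by unfold weightPairing; fun_prop
  refine IsCompact.of_isClosed_subset (isCompact_Icc (a := (0 : Fin n → ℝ))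
    (b := fun i => minValue f P / P i)) ?_ ?_
  · exact (isClosed_newtonPolyhedron f).inter (isClosed_eq hcont continuous_const)
  · rintro ξ ⟨hξ, hval⟩
    have h0 := nonneg_of_mem_newtonPolyhedron hξ
    refine ⟨h0, fun i => ?_⟩
    rw [le_div_iff₀ (hP i), ← hval, mul_comm]
    exact Finset.single_le_sum (f := fun i => P i * ξ i)
      (fun j _ => mul_nonneg (hP j).le (h0 j)) (Finset.mem_univ i)

theorem mem_support_faceFunction {n : ℕ} {f : MixedPoly n} {Δ : Set (Fin n → ℝ)}
    {m : (Fin n → ℕ) × (Fin n → ℕ)} :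
    m ∈ (faceFunction f Δ).support ↔ m ∈ f.support ∧ radialExponent m ∈ Δ := by
  classical
  simp [faceFunction, Finsupp.support_filter]

theorem eval_eq_sum {n : ℕ} (f : MixedPoly n) (z : Fin n → ℂ) : f.eval z =
    ∑ m ∈ f.support, f m * ((∏ i, z i ^ m.1 i) * ∏ i, (starRingEnd ℂ) (z i) ^ m.2 i) := rfl

open Classical in
theorem eval_faceFunction {n : ℕ} (f : MixedPoly n) (Δ : Set (Fin n → ℝ)) (z : Fin n → ℂ) :
    (faceFunction f Δ).eval z = ∑ m ∈ f.support.filter (fun m => radialExponent m ∈ Δ),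
      f m * ((∏ i, z i ^ m.1 i) * ∏ i, (starRingEnd ℂ) (z i) ^ m.2 i) := by
  rw [eval_eq_sum, faceFunction, Finsupp.support_filter]
  refine Finset.sum_congr (by congr) fun m hm => ?_
  rw [Finsupp.filter_apply_pos (fun m => radialExponent m ∈ Δ) f (Finset.mem_filter.1 hm).2]

/-! ### Polar homogeneity with respect to every weight -/

/-- A convenient mixed polynomial has a monomial in the variables `z_i`, `z̄_i` alone. -/
theorem exists_axis_monomial {n : ℕ} {f : MixedPoly n} (hconv : IsConvenient f) (i : Fin n) :
    ∃ m ∈ f.support, ∀ j, j ≠ i → radialExponent m j = 0 := by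
  obtain ⟨z, hz, hne⟩ := hconv {i} (Finset.singleton_nonempty i)
  rw [eval_eq_sum] at hne
  obtain ⟨m, hm, hterm⟩ := Finset.exists_ne_zero_of_sum_ne_zero hne
  refine ⟨m, hm, fun j hj => ?_⟩
  have hzj : z j = 0 := hz j (by simpa using hj)
  have h := right_ne_zero_of_mul hterm
  have h1 := Finset.prod_ne_zero_iff.1 (left_ne_zero_of_mul h) j (Finset.mem_univ j)
  have h2 := Finset.prod_ne_zero_iff.1 (right_ne_zero_of_mul h) j (Finset.mem_univ j)
  rw [hzj] at h1 h2
  have e1 : m.1 j = 0 := by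
    by_contra h0
    exact h1 (zero_pow h0)
  have e2 : m.2 j = 0 := by
    by_contra h0
    exact h2 (by rw [map_zero]; exact zero_pow h0)
  simp [radialExponent, e1, e2]

theorem support_nonempty_of_isConvenient {n : ℕ} (hn : n ≠ 0) {f : MixedPoly n}
    (hconv : IsConvenient f) : f.support.Nonempty :=
  let ⟨m, hm, _⟩ := exists_axis_monomial hconv ⟨0, Nat.pos_of_ne_zero hn⟩
  ⟨m, hm⟩

/-- A weight with a vanishing coordinate has `d(P) = 0` by convenience, so the monomials on its
face do not involve the variables of positive weight; in particular their polar degree is `0`. -/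
theorem polar_eq_zero_of_apply_eq_zero {n : ℕ} {f : MixedPoly n} (hconv : IsConvenient f)
    {P : Fin n → ℝ} (hP : ∀ i, 0 ≤ P i) {i : Fin n} (hi : P i = 0)
    {m : (Fin n → ℕ) × (Fin n → ℕ)}
    (hm : weightPairing P (radialExponent m) = minValue f P) :
    weightPairing P (polarExponent m) = 0 := by
  obtain ⟨m₁, hm₁, hz⟩ := exists_axis_monomial hconv i
  have hr : ∀ (m : (Fin n → ℕ) × (Fin n → ℕ)) j, 0 ≤ radialExponent m j := fun m j => by
    unfold radialExponent; positivity
  have h1 : weightPairing P (radialExponent m₁) = 0 := by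
    refine Finset.sum_eq_zero fun j _ => ?_
    by_cases h : j = i
    · rw [h, hi, zero_mul]
    · rw [hz j h, mul_zero]
  have h0 : weightPairing P (radialExponent m) = 0 := by
    refine le_antisymm (hm.trans_le ((minValue_le hP hm₁).trans_eq h1)) ?_
    exact Finset.sum_nonneg fun j _ => mul_nonneg (hP j) (hr m j)
  refine Finset.sum_eq_zero fun j _ => ?_
  have := (Finset.sum_eq_zero_iff_of_nonneg
    fun j _ => mul_nonneg (hP j) (hr m j)).1 h0 j (Finset.mem_univ j)
  rcases mul_eq_zero.1 this with h | h
  · rw [h, zero_mul]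
  · have h2 : (m.1 j : ℝ) + (m.2 j : ℝ) = 0 := h
    have e1 : (m.1 j : ℝ) = 0 := le_antisymm (by have := (m.2 j).cast_nonneg (α := ℝ); linarith)
      (Nat.cast_nonneg _)
    have e2 : (m.2 j : ℝ) = 0 := by linarith
    simp [polarExponent, e1, e2]

open Classical in
/-- The face function of *every* non-negative weight `P` is polar homogeneous with respect to `P`
itself. The face type hypothesis only provides some weight `Q ≫ 0` with `Δ(Q) = Δ(P)`. One moves
from `P` in the direction `-Q` until a coordinate vanishes or a further monomial becomes minimal:
this writes `P = R + tQ` with `Δ(P) ⊆ Δ(R)`, and `R` is either covered by convenience or has fewer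
non-minimal monomials. -/
theorem polar_homogeneous_of_nonneg {n : ℕ} (hn : n ≠ 0) {f : MixedPoly n}
    (hconv : IsConvenient f) (hface : IsStronglyPolarNonnegFaceType f) (P : Fin n → ℝ)
    (hP : ∀ i, 0 ≤ P i) : ∃ d : ℝ, ∀ m ∈ f.support,
      weightPairing P (radialExponent m) = minValue f P →
        weightPairing P (polarExponent m) = d := by
  induction hk : (f.support.filter fun m =>
    weightPairing P (radialExponent m) ≠ minValue f P).card using Nat.strong_induction_on
    generalizing P with
  | _ k ih =>
  by_cases hpos : ∃ i, P i = 0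
  · obtain ⟨i, hi⟩ := hpos
    exact ⟨0, fun m _ h => polar_eq_zero_of_apply_eq_zero hconv hP hi h⟩
  push Not at hpos
  have hP' : ∀ i, 0 < P i := fun i => lt_of_le_of_ne (hP i) (hpos i).symm
  obtain ⟨Q, hQ, hQP, -, dp, -, hdp⟩ := hface _ (isCompactFace_face hn f hP')
  have hQ0 : ∀ i, 0 ≤ Q i := fun i => (hQ i).le
  have htight : ∀ m ∈ f.support, weightPairing Q (radialExponent m) = minValue f Q ↔
      weightPairing P (radialExponent m) = minValue f P := fun m hm => by
    rw [← radialExponent_mem_face hm, hQP, radialExponent_mem_face hm]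
  -- the two kinds of constraints on `R = P - tQ`, each recorded as a bound for `t`
  set N := f.support.filter fun m => weightPairing P (radialExponent m) ≠ minValue f P with hN
  let C : Finset (Fin n ⊕ (Fin n → ℕ) × (Fin n → ℕ)) := Finset.univ.disjSum N
  let bound : Fin n ⊕ (Fin n → ℕ) × (Fin n → ℕ) → ℝ := Sum.elim (fun i => P i / Q i) fun m =>
    (weightPairing P (radialExponent m) - minValue f P) /
      (weightPairing Q (radialExponent m) - minValue f Q)
  have hC : C.Nonempty := ⟨Sum.inl ⟨0, Nat.pos_of_ne_zero hn⟩, by simp [C]⟩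
  obtain ⟨c, hc, hcmin⟩ := Finset.exists_min_image C bound hC
  set t := bound c with ht
  have hQN : ∀ m ∈ N, 0 < weightPairing Q (radialExponent m) - minValue f Q := fun m hm => by
    obtain ⟨hm, hne⟩ := Finset.mem_filter.1 hm
    exact sub_pos.2 (lt_of_le_of_ne (minValue_le hQ0 hm) fun h => hne ((htight m hm).1 h.symm))
  have ht1 : ∀ i, t * Q i ≤ P i := fun i =>
    (le_div_iff₀ (hQ i)).1 (hcmin (Sum.inl i) (by simp [C]))
  have ht2 : ∀ m ∈ f.support, t * (weightPairing Q (radialExponent m) - minValue f Q) ≤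
      weightPairing P (radialExponent m) - minValue f P := fun m hm => by
    by_cases h : weightPairing P (radialExponent m) = minValue f P
    · rw [h, (htight m hm).2 h]; simp
    · have hmN : m ∈ N := Finset.mem_filter.2 ⟨hm, h⟩
      exact (le_div_iff₀ (hQN m hmN)).1 (hcmin (Sum.inr m) (by simpa [C] using hmN))
  have hR : ∀ i, 0 ≤ (P - t • Q) i := fun i => by simpa using ht1 i
  obtain ⟨m₀, hm₀, hm₀P⟩ := exists_minValue_eq (support_nonempty_of_isConvenient hn hconv) hP
  have hm₀Q := (htight m₀ hm₀).2 hm₀P.symm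
  have hminR : minValue f (P - t • Q) = minValue f P - t * minValue f Q := by
    rw [minValue_eq hR hm₀, weightPairing_sub_left, ← hm₀P, hm₀Q]
    intro m hm
    rw [weightPairing_sub_left, weightPairing_sub_left, ← hm₀P, hm₀Q]
    linarith [ht2 m hm]
  have hsub : ∀ m ∈ f.support, weightPairing P (radialExponent m) = minValue f P →
      weightPairing (P - t • Q) (radialExponent m) = minValue f (P - t • Q) := fun m hm h => by
    rw [hminR, weightPairing_sub_left, h, (htight m hm).2 h]
  have hRpolar : ∃ d : ℝ, ∀ m ∈ f.support,
      weightPairing (P - t • Q) (radialExponent m) = minValue f (P - t • Q) →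
        weightPairing (P - t • Q) (polarExponent m) = d := by
    rcases c with i | m₁
    · have hi : (P - t • Q) i = 0 := by
        have : t * Q i = P i := div_mul_cancel₀ _ (hQ i).ne'
        simp [this]
      exact ⟨0, fun m _ h => polar_eq_zero_of_apply_eq_zero hconv hR hi h⟩
    · have hm₁ : m₁ ∈ N := by simpa [C] using hc
      obtain ⟨hm₁s, hm₁P⟩ := Finset.mem_filter.1 hm₁
      refine ih _ ?_ _ hR rfl
      rw [← hk]
      refine Finset.card_lt_card ((Finset.ssubset_iff_of_subset ?_).2 ⟨m₁, hm₁, ?_⟩)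
      · intro m hm
        obtain ⟨hm, hne⟩ := Finset.mem_filter.1 hm
        exact Finset.mem_filter.2 ⟨hm, fun h => hne (hsub m hm h)⟩
      · have : t * (weightPairing Q (radialExponent m₁) - minValue f Q) =
            weightPairing P (radialExponent m₁) - minValue f P :=
          div_mul_cancel₀ _ (hQN m₁ hm₁).ne'
        simp only [Finset.mem_filter, not_and, not_not]
        intro _
        rw [hminR, weightPairing_sub_left]
        linarith
  obtain ⟨d, hd⟩ := hRpolar
  refine ⟨d + t * dp, fun m hm h => ?_⟩
  have h1 := hd m hm (hsub m hm h)
  have h2 : weightPairing Q (polarExponent m) = dp :=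
    hdp m (mem_support_faceFunction.2 ⟨hm, (radialExponent_mem_face hm).2 h⟩)
  rw [weightPairing_sub_left, h2] at h1
  linarith

/-! ### The face attached to a cone -/

theorem weightPairing_sum_left {n : ℕ} {ι : Type*} (s : Finset ι) (P : ι → Fin n → ℝ)
    (ξ : Fin n → ℝ) : weightPairing (∑ k ∈ s, P k) ξ = ∑ k ∈ s, weightPairing (P k) ξ := by
  simp only [weightPairing, Finset.sum_apply, Finset.sum_mul]
  exact Finset.sum_comm

/-- The faces of the vertices of a cone have a common monomial: by admissibility a monomial that is
minimal for one weight in the interior is minimal for all of them, hence in the limit also for the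
vertices. -/
theorem exists_common_monomial {n : ℕ} {f : MixedPoly n} (hf : f.support.Nonempty)
    {S : RegularSubdivision n} (hadm : S.IsAdmissible f) {τ : Finset (Fin n → ℕ)}
    (hτ : τ ∈ S.cones) :
    ∃ m₀ ∈ f.support, ∀ P ∈ τ, radialExponent m₀ ∈ face f (toReal P) := by
  classical
  have h0 : ∀ P : Fin n → ℕ, ∀ i, 0 ≤ toReal P i := fun P i => Nat.cast_nonneg _
  have hW : ∀ i, 0 ≤ (∑ P ∈ τ, toReal P) i := fun i => by
    rw [Finset.sum_apply]; exact Finset.sum_nonneg fun P _ => h0 P i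
  obtain ⟨m₀, hm₀, hval⟩ := exists_minValue_eq hf hW
  refine ⟨m₀, hm₀, fun P hP => (radialExponent_mem_face hm₀).2 (minValue_eq (h0 P) hm₀ ?_).symm⟩
  intro m hm
  by_contra! hlt
  have hmin0 := hval ▸ minValue_le hW hm
  set a := weightPairing (∑ P ∈ τ, toReal P) (radialExponent m) -
    weightPairing (∑ P ∈ τ, toReal P) (radialExponent m₀) with ha
  set b := weightPairing (toReal P) (radialExponent m₀) -
    weightPairing (toReal P) (radialExponent m) with hb
  have hb0 : 0 < b := sub_pos.2 hlt
  have ha0 : 0 ≤ a := sub_nonneg.2 hmin0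
  -- for this `r` the weight `∑ P + r P` is strictly smaller at `m` than at `m₀`
  set r := (a + 1) / b with hr
  have hr0 : 0 ≤ r := by positivity
  have hWr : (∑ P ∈ τ, toReal P) - (-r) • toReal P = ∑ Q ∈ τ, (if Q = P then 1 + r else 1) •
      toReal Q := by
    have : ∀ Q ∈ τ, (if Q = P then 1 + r else 1) • toReal Q =
        toReal Q + if Q = P then r • toReal P else 0 := fun Q _ => by
      by_cases h : Q = P
      · subst h; simp [add_smul]
      · simp [h]
    rw [Finset.sum_congr rfl this, Finset.sum_add_distrib, Finset.sum_ite_eq' τ P, if_pos hP]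
    simp
  have hface := hadm τ hτ (∑ P ∈ τ, toReal P) ⟨fun _ => 1, fun _ _ => one_pos, by simp⟩
    ((∑ P ∈ τ, toReal P) - (-r) • toReal P)
    ⟨fun Q => if Q = P then 1 + r else 1, fun Q _ => by dsimp only; split_ifs <;> positivity, hWr⟩
  have hmem : radialExponent m₀ ∈ face f ((∑ P ∈ τ, toReal P) - (-r) • toReal P) :=
    hface ▸ (radialExponent_mem_face hm₀).2 hval.symm
  have hle := minValue_le (f := f) (P := (∑ P ∈ τ, toReal P) - (-r) • toReal P) (fun i => by
    have := mul_nonneg hr0 (h0 P i)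
    have := hW i
    simp only [Pi.sub_apply, Pi.smul_apply, smul_eq_mul]
    linarith) hm
  rw [← hmem.2, weightPairing_sub_left, weightPairing_sub_left] at hle
  have : r * b = a + 1 := div_mul_cancel₀ _ hb0.ne'
  rw [hb] at this
  linarith

/-- The weight `∑_{P ∈ τ} P` in the interior of a cone has the face `⋂_{P ∈ τ} Δ(P)`. -/
theorem mem_face_sum_iff {n : ℕ} {f : MixedPoly n} (hf : f.support.Nonempty)
    {S : RegularSubdivision n} (hadm : S.IsAdmissible f) {τ : Finset (Fin n → ℕ)}
    (hτ : τ ∈ S.cones) {m : (Fin n → ℕ) × (Fin n → ℕ)} (hm : m ∈ f.support) :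
    radialExponent m ∈ face f (∑ P ∈ τ, toReal P) ↔
      ∀ P ∈ τ, radialExponent m ∈ face f (toReal P) := by
  obtain ⟨m₀, hm₀, hface⟩ := exists_common_monomial hf hadm hτ
  have h0 : ∀ P : Fin n → ℕ, ∀ i, 0 ≤ toReal P i := fun P i => Nat.cast_nonneg _
  have hW : ∀ i, 0 ≤ (∑ P ∈ τ, toReal P) i := fun i => by
    rw [Finset.sum_apply]; exact Finset.sum_nonneg fun P _ => h0 P i
  have hle : ∀ m ∈ f.support, ∀ P ∈ τ,
      minValue f (toReal P) ≤ weightPairing (toReal P) (radialExponent m) :=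
    fun m hm P _ => minValue_le (h0 P) hm
  have hval : minValue f (∑ P ∈ τ, toReal P) = ∑ P ∈ τ, minValue f (toReal P) := by
    rw [minValue_eq hW hm₀, weightPairing_sum_left]
    · exact Finset.sum_congr rfl fun P hP => (hface P hP).2
    · intro m hm
      rw [weightPairing_sum_left, weightPairing_sum_left]
      exact Finset.sum_le_sum fun P hP => (hface P hP).2.trans_le (hle m hm P hP)
  rw [radialExponent_mem_face hm, hval, weightPairing_sum_left, eq_comm,
    Finset.sum_eq_sum_iff_of_le (hle m hm)]
  exact forall₂_congr fun P _ => by rw [radialExponent_mem_face hm, eq_comm]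

/-! ### Dual bases of maximal cones -/

/-- The vertices of a maximal cone form a `ℤ`-basis of `ℤⁿ`; its dual basis. -/
theorem exists_dualBasis {n : ℕ} {S : RegularSubdivision n} (σ : S.MaxCone) :
    ∃ B : {P : Fin n → ℕ // P ∈ σ.1} → Fin n → ℤ,
      (∀ P Q, ∑ i, B P i * (Q.1 i : ℤ) = if P = Q then 1 else 0) ∧
      ∀ i j, ∑ P, B P i * (P.1 j : ℤ) = if i = j then 1 else 0 := by
  classical
  obtain ⟨b, hb⟩ := S.regular σ.1 σ.2.1
  choose k hk using fun P : {P : Fin n → ℕ // P ∈ σ.1} => hb P.1 P.2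
  have hinj : Function.Injective k := fun P Q h => by
    have h1 := (hk P).symm.trans ((congrArg b h).trans (hk Q))
    exact Subtype.ext (funext fun i => by exact_mod_cast congrFun h1 i)
  have hbij : Function.Bijective k := (Fintype.bijective_iff_injective_and_card k).2
    ⟨hinj, by simpa using σ.2.2⟩
  let e : {P : Fin n → ℕ // P ∈ σ.1} ≃ Fin n := Equiv.ofBijective k hbij
  have hrep : ∀ (v : Fin n → ℤ) r, ∑ i, b.repr (Pi.single i 1) r * v i = b.repr v r := by
    intro v r
    conv_rhs => rw [← Finset.univ_sum_single v]
    rw [map_sum, Finsupp.finsetSum_apply]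
    refine Finset.sum_congr rfl fun i _ => ?_
    have : Pi.single i (v i) = v i • (Pi.single i 1 : Fin n → ℤ) := by
      rw [← Pi.single_smul]; simp
    rw [this, map_smul]
    simp [mul_comm]
  refine ⟨fun P i => b.repr (Pi.single i 1) (k P), fun P Q => ?_, fun i j => ?_⟩
  · rw [hrep (fun i => (Q.1 i : ℤ)), ← hk Q, b.repr_self, Finsupp.single_apply]
    simp [hinj.eq_iff, eq_comm]
  · have h1 := b.sum_repr (Pi.single i 1)
    have h2 : ∑ P, b.repr (Pi.single i 1) (k P) • b (k P) = Pi.single i 1 :=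
      (e.sum_comp fun r => b.repr (Pi.single i 1) r • b r).trans h1
    have h3 := congrFun h2 j
    rw [Finset.sum_apply] at h3
    simp only [hk, Pi.smul_apply, smul_eq_mul] at h3
    rw [h3, Pi.single_apply]
    simp [eq_comm]

/-- The dual basis of the vertices of `σ`. -/
noncomputable def dualBasis {n : ℕ} {S : RegularSubdivision n} (σ : S.MaxCone) :
    {P : Fin n → ℕ // P ∈ σ.1} → Fin n → ℤ :=
  (exists_dualBasis σ).choose

/-- The pairing of an integral covector with an integral weight. -/
def intPairing {n : ℕ} (a : Fin n → ℤ) (P : Fin n → ℕ) : ℤ := ∑ i, a i * (P i : ℤ)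

open Classical in
theorem intPairing_dualBasis {n : ℕ} {S : RegularSubdivision n} (σ : S.MaxCone)
    (P Q : {P : Fin n → ℕ // P ∈ σ.1}) :
    intPairing (dualBasis σ P) Q.1 = if P = Q then 1 else 0 := by
  have := (exists_dualBasis σ).choose_spec.1 P Q
  simpa [intPairing, dualBasis] using this

theorem sum_dualBasis {n : ℕ} {S : RegularSubdivision n} (σ : S.MaxCone) (i j : Fin n) :
    ∑ P, dualBasis σ P i * (P.1 j : ℤ) = if i = j then 1 else 0 :=
  (exists_dualBasis σ).choose_spec.2 i j

/-- Every weight is the combination of the vertices of `σ` given by the dual basis. -/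
theorem sum_intPairing_dualBasis {n : ℕ} {S : RegularSubdivision n} (σ : S.MaxCone)
    (P : Fin n → ℕ) (i : Fin n) :
    ∑ Q, intPairing (dualBasis σ Q) P * (Q.1 i : ℤ) = (P i : ℤ) := by
  simp only [intPairing, Finset.sum_mul]
  rw [Finset.sum_comm]
  have : ∀ j, ∑ Q, dualBasis σ Q j * (P j : ℤ) * (Q.1 i : ℤ) =
      (P j : ℤ) * if j = i then 1 else 0 := fun j => by
    rw [← sum_dualBasis σ j i, Finset.mul_sum]
    exact Finset.sum_congr rfl fun Q _ => by ring
  rw [Finset.sum_congr rfl fun j _ => this j]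
  simp

/-- The coordinates of a weight with respect to the vertices of `σ` are unique. -/
theorem eq_intPairing_of_sum_eq {n : ℕ} {S : RegularSubdivision n} (σ : S.MaxCone)
    {P : Fin n → ℕ} {A : {Q : Fin n → ℕ // Q ∈ σ.1} → ℤ}
    (hA : ∀ i, (P i : ℤ) = ∑ Q, A Q * (Q.1 i : ℤ)) (Q : {Q : Fin n → ℕ // Q ∈ σ.1}) :
    A Q = intPairing (dualBasis σ Q) P := by
  classical
  simp only [intPairing, hA, Finset.mul_sum]
  rw [Finset.sum_comm]
  have : ∀ R, ∑ i, dualBasis σ Q i * (A R * (R.1 i : ℤ)) = A R * if Q = R then 1 else 0 :=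
    fun R => by
      rw [← intPairing_dualBasis σ Q R, intPairing, Finset.mul_sum]
      exact Finset.sum_congr rfl fun i _ => by ring
  rw [Finset.sum_congr rfl fun R _ => this R]
  simp

/-- A vertex of `σ` lying in the cone of another maximal cone `τ` is a vertex of `τ`. -/
theorem mem_of_nonneg_intPairing {n : ℕ} {S : RegularSubdivision n} {σ τ : S.MaxCone}
    {P : Fin n → ℕ} (hP : P ∈ σ.1) (h : ∀ Q, 0 ≤ intPairing (dualBasis τ Q) P) : P ∈ τ.1 := by
  classical
  have h1 : toReal P ∈ cone σ.1 :=
    ⟨fun Q => if Q = P then 1 else 0, fun Q _ => by dsimp only; split_ifs <;> norm_num, by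
      simp [hP]⟩
  have h2 : toReal P ∈ cone τ.1 := by
    refine ⟨fun Q => if hQ : Q ∈ τ.1 then (intPairing (dualBasis τ ⟨Q, hQ⟩) P : ℝ) else 0,
      fun Q hQ => ?_, ?_⟩
    · simpa [hQ] using h ⟨Q, hQ⟩
    · funext i
      rw [Finset.sum_apply, ← Finset.sum_coe_sort]
      have := congrArg (Int.cast (R := ℝ)) (sum_intPairing_dualBasis τ P i)
      push_cast at this
      simpa [toReal] using this.symm
  have h3 : toReal P ∈ cone (σ.1 ∩ τ.1) := S.inter _ σ.2.1 _ τ.2.1 ▸ ⟨h1, h2⟩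
  obtain ⟨r, -, hr⟩ := h3
  by_contra hPτ
  -- pairing the relation with the dual vector of `P` gives `1 = 0`
  have hpair : ∀ Q ∈ σ.1 ∩ τ.1, ∑ i, (dualBasis σ ⟨P, hP⟩ i : ℝ) * toReal Q i = 0 := by
    intro Q hQ
    have hQσ := (Finset.mem_inter.1 hQ).1
    have hne : (⟨P, hP⟩ : {P : Fin n → ℕ // P ∈ σ.1}) ≠ ⟨Q, hQσ⟩ := fun h => by
      rw [Subtype.mk.injEq] at h
      exact hPτ (h ▸ (Finset.mem_inter.1 hQ).2)
    have := congrArg (Int.cast (R := ℝ)) (intPairing_dualBasis σ ⟨P, hP⟩ ⟨Q, hQσ⟩)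
    rw [if_neg hne] at this
    simpa [intPairing, toReal] using this
  have h1 : ∑ i, (dualBasis σ ⟨P, hP⟩ i : ℝ) * toReal P i = 1 := by
    have := congrArg (Int.cast (R := ℝ)) (intPairing_dualBasis σ ⟨P, hP⟩ ⟨P, hP⟩)
    simpa [intPairing, toReal] using this
  have h0 : ∑ i, (dualBasis σ ⟨P, hP⟩ i : ℝ) * toReal P i = 0 := by
    have : ∀ i, toReal P i = ∑ Q ∈ σ.1 ∩ τ.1, r Q * toReal Q i := fun i => by
      conv_lhs => rw [hr]
      simp
    simp only [this, Finset.mul_sum]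
    rw [Finset.sum_comm]
    refine Finset.sum_eq_zero fun Q hQ => ?_
    rw [← mul_zero (r Q), ← hpair Q hQ, Finset.mul_sum]
    exact Finset.sum_congr rfl fun i _ => by ring
  exact one_ne_zero (h1.symm.trans h0)

/-! ### The gluing relation -/

/-- The set of vertices whose toric coordinates vanish at a point of a chart. -/
def zeroVertices {n : ℕ} {S : RegularSubdivision n} {σ : S.MaxCone} (u : ChartSpace σ) :
    Set (Fin n → ℕ) :=
  {P | ∃ h : P ∈ σ.1, u ⟨P, h⟩ = 0}

/-- The value at a point of a chart of the Laurent monomial with exponent `a`. It is meaningful if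
`a` is orthogonal to the vertices whose coordinates vanish (then `0 ^ 0 = 1` applies to these). -/
noncomputable def character {n : ℕ} {S : RegularSubdivision n} {σ : S.MaxCone} (u : ChartSpace σ)
    (a : Fin n → ℤ) : ℂ :=
  ∏ P, u P ^ intPairing a P.1

theorem glue_iff_intPairing {n : ℕ} {S : RegularSubdivision n}
    (p q : (σ : S.MaxCone) × ChartSpace σ) :
    Glue S p q ↔
      (∀ Q P, intPairing (dualBasis q.1 Q) P.1 < 0 → p.2 P ≠ 0) ∧
        ∀ Q, q.2 Q = ∏ P, p.2 P ^ intPairing (dualBasis q.1 Q) P.1 := by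
  constructor
  · rintro ⟨A, hA, h1, h2⟩
    have hA' : ∀ Q P, A Q P = intPairing (dualBasis q.1 Q) P.1 := fun Q P =>
      eq_intPairing_of_sum_eq q.1 (A := fun Q => A Q P) (hA P) Q
    simp only [hA'] at h1 h2
    exact ⟨h1, h2⟩
  · rintro ⟨h1, h2⟩
    exact ⟨fun Q P => intPairing (dualBasis q.1 Q) P.1,
      fun P i => (sum_intPairing_dualBasis q.1 P.1 i).symm, h1, h2⟩

theorem zpow_sum_eq_prod {ι : Type*} (s : Finset ι) {z : ℂ} (a : ι → ℤ)
    (h : z ≠ 0 ∨ ∀ i ∈ s, a i = 0) : z ^ (∑ i ∈ s, a i) = ∏ i ∈ s, z ^ a i := by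
  rcases h with h | h
  · induction s using Finset.cons_induction with
    | empty => simp
    | cons i s hi ih => rw [Finset.sum_cons, Finset.prod_cons, zpow_add₀ h, ih]
  · rw [Finset.sum_eq_zero h, Finset.prod_congr rfl fun i hi => by rw [h i hi]]
    simp

/-- Points of two charts are glued if and only if the same coordinates vanish and the Laurent
monomials that make sense agree. Unlike the definition of the gluing, this is visibly an
equivalence relation; the fan property is what makes the vanishing coordinates agree. -/
theorem glue_iff {n : ℕ} {S : RegularSubdivision n} (p q : (σ : S.MaxCone) × ChartSpace σ) :
    Glue S p q ↔ zeroVertices p.2 = zeroVertices q.2 ∧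
      ∀ a, (∀ P ∈ zeroVertices p.2, intPairing a P = 0) → character p.2 a = character q.2 a := by
  classical
  obtain ⟨σ, u⟩ := p
  obtain ⟨τ, v⟩ := q
  rw [glue_iff_intPairing]
  constructor
  · rintro ⟨h1, h2⟩
    dsimp only at h1 h2 ⊢
    have hmem : ∀ P, u P = 0 → P.1 ∈ τ.1 := fun P hP =>
      mem_of_nonneg_intPairing P.2 fun Q => not_lt.1 fun h => h1 Q P h hP
    have hδ : ∀ P (hP : u P = 0) Q, intPairing (dualBasis τ Q) P.1 =
        if Q = ⟨P.1, hmem P hP⟩ then 1 else 0 := fun P hP Q =>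
      intPairing_dualBasis τ Q ⟨P.1, hmem P hP⟩
    refine ⟨Set.Subset.antisymm ?_ ?_, fun a ha => ?_⟩
    · rintro P ⟨hP, h0⟩
      refine ⟨hmem ⟨P, hP⟩ h0, ?_⟩
      rw [h2]
      refine Finset.prod_eq_zero (Finset.mem_univ ⟨P, hP⟩) ?_
      rw [h0, hδ ⟨P, hP⟩ h0]
      simp
    · rintro Q ⟨hQ, h0⟩
      rw [h2] at h0
      obtain ⟨P, -, hP⟩ := Finset.prod_eq_zero_iff.1 h0
      have hu : u P = 0 := by
        by_contra hne
        exact zpow_ne_zero _ hne hP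
      have hne : intPairing (dualBasis τ ⟨Q, hQ⟩) P.1 ≠ 0 := fun h => by
        rw [h, zpow_zero] at hP
        exact one_ne_zero hP
      rw [hδ P hu] at hne
      have hQP : (⟨Q, hQ⟩ : {Q : Fin n → ℕ // Q ∈ τ.1}) = ⟨P.1, hmem P hu⟩ := by
        by_contra h
        exact hne (if_neg h)
      rw [Subtype.mk.injEq] at hQP
      subst hQP
      exact ⟨P.2, hu⟩
    · have hexp : ∀ P : {P : Fin n → ℕ // P ∈ σ.1}, intPairing a P.1 =
          ∑ Q, intPairing (dualBasis τ Q) P.1 * intPairing a Q.1 := fun P => by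
        simp only [intPairing, Finset.mul_sum]
        rw [Finset.sum_comm]
        refine Finset.sum_congr rfl fun i _ => ?_
        rw [← sum_intPairing_dualBasis τ P.1 i, Finset.mul_sum]
        exact Finset.sum_congr rfl fun Q _ => by rw [intPairing]; ring
      have hzero : ∀ P, u P ≠ 0 ∨
          ∀ Q ∈ Finset.univ, intPairing (dualBasis τ Q) P.1 * intPairing a Q.1 = 0 := by
        intro P
        by_cases hP : u P = 0
        · refine Or.inr fun Q _ => ?_
          rw [hδ P hP]
          split_ifs with h
          · rw [h, ha P.1 ⟨P.2, hP⟩, mul_zero]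
          · rw [zero_mul]
        · exact Or.inl hP
      calc character u a = ∏ P, ∏ Q, (u P ^ intPairing (dualBasis τ Q) P.1) ^ intPairing a Q.1 := by
            refine Finset.prod_congr rfl fun P _ => ?_
            rw [hexp P, zpow_sum_eq_prod _ _ (hzero P)]
            exact Finset.prod_congr rfl fun Q _ => zpow_mul _ _ _
        _ = character v a := by
            rw [Finset.prod_comm]
            refine Finset.prod_congr rfl fun Q _ => ?_
            rw [Finset.prod_zpow, h2 Q]
  · rintro ⟨hZ, hχ⟩
    dsimp only at hZ hχ ⊢
    have hmem : ∀ P, u P = 0 → ∃ h : P.1 ∈ τ.1, v ⟨P.1, h⟩ = 0 := fun P hP =>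
      hZ.subset ⟨P.2, hP⟩
    have hδ : ∀ P (hP : u P = 0) Q, intPairing (dualBasis τ Q) P.1 =
        if Q = ⟨P.1, (hmem P hP).1⟩ then 1 else 0 := fun P hP Q =>
      intPairing_dualBasis τ Q ⟨P.1, (hmem P hP).1⟩
    refine ⟨fun Q P hneg hP => ?_, fun Q => ?_⟩
    · rw [hδ P hP] at hneg
      split_ifs at hneg <;> omega
    · by_cases hQ : v Q = 0
      · obtain ⟨h, h0⟩ : Q.1 ∈ zeroVertices u := hZ ▸ ⟨Q.2, hQ⟩
        rw [hQ]
        refine (Finset.prod_eq_zero (Finset.mem_univ ⟨Q.1, h⟩) ?_).symm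
        rw [h0, hδ ⟨Q.1, h⟩ h0 Q]
        simp
      · have := hχ (dualBasis τ Q) (by
          rintro P ⟨hPσ, hP⟩
          rw [hδ ⟨P, hPσ⟩ hP Q, if_neg]
          rintro rfl
          exact hQ (hmem ⟨P, hPσ⟩ hP).2)
        rw [character, character] at this
        rw [this]
        simp only [intPairing_dualBasis]
        rw [Finset.prod_eq_single Q]
        · simp
        · intro R _ hR
          rw [if_neg hR.symm, zpow_zero]
        · simp

theorem glue_equivalence {n : ℕ} (S : RegularSubdivision n) : Equivalence (Glue S) where
  refl p := (glue_iff p p).2 ⟨rfl, fun _ _ => rfl⟩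
  symm {p q} h := by
    obtain ⟨hZ, hχ⟩ := (glue_iff p q).1 h
    exact (glue_iff q p).2 ⟨hZ.symm, fun a ha => (hχ a (hZ ▸ ha)).symm⟩
  trans {p q r} h h' := by
    obtain ⟨hZ, hχ⟩ := (glue_iff p q).1 h
    obtain ⟨hZ', hχ'⟩ := (glue_iff q r).1 h'
    exact (glue_iff p r).2 ⟨hZ.trans hZ', fun a ha => (hχ a ha).trans (hχ' a (hZ ▸ ha))⟩

theorem chartIncl_eq_iff {n : ℕ} {S : RegularSubdivision n} {σ τ : S.MaxCone}
    {u : ChartSpace σ} {v : ChartSpace τ} :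
    chartIncl σ u = chartIncl τ v ↔ Glue S ⟨σ, u⟩ ⟨τ, v⟩ :=
  (glue_equivalence S).quot_mk_eq_iff _ _

theorem zeroVertices_eq_of_chartIncl_eq {n : ℕ} {S : RegularSubdivision n} {σ τ : S.MaxCone}
    {u : ChartSpace σ} {v : ChartSpace τ} (h : chartIncl σ u = chartIncl τ v) :
    zeroVertices u = zeroVertices v :=
  ((glue_iff _ _).1 (chartIncl_eq_iff.1 h)).1

theorem exists_eq_chartIncl {n : ℕ} {S : RegularSubdivision n} (x : ToricModification S) :
    ∃ (σ : S.MaxCone) (u : ChartSpace σ), x = chartIncl σ u := by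
  obtain ⟨⟨σ, u⟩, rfl⟩ := Quot.exists_rep x
  exact ⟨σ, u, rfl⟩

theorem chartIncl_mem_divisor {n : ℕ} {S : RegularSubdivision n} {σ : S.MaxCone}
    {u : ChartSpace σ} {P : Fin n → ℕ} : chartIncl σ u ∈ divisor S P ↔ P ∈ zeroVertices u := by
  constructor
  · rintro ⟨τ, hP, v, hv, h⟩
    rw [zeroVertices_eq_of_chartIncl_eq h]
    exact ⟨hP, hv⟩
  · rintro ⟨hP, h⟩
    exact ⟨σ, hP, u, h, rfl⟩

theorem chartIncl_mem_divisorStratum {n : ℕ} {S : RegularSubdivision n} {σ : S.MaxCone}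
    {u : ChartSpace σ} {τ : Finset (Fin n → ℕ)} :
    chartIncl σ u ∈ divisorStratum S τ ↔ zeroVertices u = (τ : Set (Fin n → ℕ)) := by
  simp only [divisorStratum, Set.mem_sdiff, Set.mem_iInter, Set.mem_iUnion, chartIncl_mem_divisor,
    Set.mem_ofPred_eq, not_exists, exists_prop, not_and, and_imp]
  constructor
  · rintro ⟨h1, h2⟩
    refine Set.Subset.antisymm (fun Q hQ => ?_) h1
    by_contra hQτ
    obtain ⟨hQσ, -⟩ := id hQ
    exact h2 Q (S.face_mem _ σ.2.1 _ (Finset.singleton_subset_iff.2 hQσ)) hQτ hQ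
  · intro h
    rw [h]
    exact ⟨fun P hP => hP, fun Q _ hQ => hQ⟩

/-! ### The topology of the toric modification -/

theorem continuous_chartIncl {n : ℕ} {S : RegularSubdivision n} (σ : S.MaxCone) :
    Continuous (chartIncl σ) :=
  continuous_quot_mk.comp continuous_sigmaMk

theorem isOpenMap_chartIncl {n : ℕ} {S : RegularSubdivision n} (σ : S.MaxCone) :
    IsOpenMap (chartIncl σ) := by
  intro W hW
  refine isOpen_coinduced.2 (isOpen_sigma_iff.2 fun τ => ?_)
  let D : Set (ChartSpace τ) := ⋂ (P : {P : Fin n → ℕ // P ∈ σ.1})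
    (Q : {P : Fin n → ℕ // P ∈ τ.1}), {v | intPairing (dualBasis σ P) Q.1 < 0 → v Q ≠ 0}
  let M : ChartSpace τ → ChartSpace σ := fun v P => ∏ Q, v Q ^ intPairing (dualBasis σ P) Q.1
  have hD : IsOpen D := by
    refine isOpen_iInter_of_finite fun P => isOpen_iInter_of_finite fun Q => ?_
    by_cases h : intPairing (dualBasis σ P) Q.1 < 0
    · simpa [h] using isOpen_ne_fun (continuous_apply Q) continuous_const
    · simp [h]
  have hM : ContinuousOn M D := by
    refine continuousOn_pi.2 fun P => continuousOn_finsetProd _ fun Q _ => ?_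
    refine (continuous_apply Q).continuousOn.zpow₀ _ fun v hv => ?_
    by_cases h : intPairing (dualBasis σ P) Q.1 < 0
    · exact Or.inl (Set.mem_iInter₂.1 hv P Q h)
    · exact Or.inr (not_lt.1 h)
  convert! hM.isOpen_inter_preimage hD hW using 1
  ext v
  constructor
  · rintro ⟨u, hu, h⟩
    obtain ⟨h1, h2⟩ := (glue_iff_intPairing _ _).1 (chartIncl_eq_iff.1 h.symm)
    refine ⟨Set.mem_iInter₂.2 fun P Q => h1 P Q, ?_⟩
    have : M v = u := funext fun P => (h2 P).symm
    rwa [Set.mem_preimage, this]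
  · rintro ⟨h1, h2⟩
    exact ⟨M v, h2, (chartIncl_eq_iff.2
      ((glue_iff_intPairing _ _).2 ⟨fun P Q => Set.mem_iInter₂.1 h1 P Q, fun P => rfl⟩)).symm⟩

/-- The strict transform seen in a toric chart: the closure of `{f ∘ π_σ = 0, π_σ ≠ 0}`. -/
def chartStrictTransform {n : ℕ} {S : RegularSubdivision n} (f : MixedPoly n) (σ : S.MaxCone) :
    Set (ChartSpace σ) :=
  closure {u | f.eval (chartProj σ u) = 0 ∧ chartProj σ u ≠ 0}

theorem chartIncl_mem_strictTransform {n : ℕ} {S : RegularSubdivision n} {f : MixedPoly n}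
    {σ : S.MaxCone} {u : ChartSpace σ} :
    chartIncl σ u ∈ strictTransform S f ↔ u ∈ chartStrictTransform f σ := by
  rw [strictTransform, ← Set.mem_preimage,
    (isOpenMap_chartIncl σ).preimage_closure_eq_closure_preimage (continuous_chartIncl σ)]
  rfl

theorem chartIncl_mem_exceptionalSet {n : ℕ} {S : RegularSubdivision n} {σ : S.MaxCone}
    {u : ChartSpace σ} : chartIncl σ u ∈ exceptionalSet S ↔ chartProj σ u = 0 := Iff.rfl

/-! ### Submersions and flattenings -/

/-- `M` is an embedded `C^s`-submanifold of dimension `d` near the point `x`. -/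
def IsSubmanifoldAt {E : Type*} [NormedAddCommGroup E] [NormedSpace ℝ E] (s : WithTop ℕ∞) (d : ℕ)
    (M : Set E) (x : E) : Prop :=
  ∃ (φ : OpenPartialHomeomorph E E) (W : Submodule ℝ E),
    x ∈ φ.source ∧ ContDiffOn ℝ s φ φ.source ∧ ContDiffOn ℝ s φ.symm φ.target ∧
    Module.finrank ℝ W = d ∧ φ.IsImage M (W : Set E)

theorem IsSubmanifoldAt.of_le {E : Type*} [NormedAddCommGroup E] [NormedSpace ℝ E]
    {s t : WithTop ℕ∞} {d : ℕ} {M : Set E} {x : E} (h : IsSubmanifoldAt s d M x) (hts : t ≤ s) :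
    IsSubmanifoldAt t d M x :=
  let ⟨φ, W, hx, h1, h2, hW, hM⟩ := h
  ⟨φ, W, hx, h1.of_le hts, h2.of_le hts, hW, hM⟩

theorem exists_continuous_rightInverse {E F : Type*} [NormedAddCommGroup E] [NormedSpace ℝ E]
    [NormedAddCommGroup F] [NormedSpace ℝ F] [FiniteDimensional ℝ F] {L : E →L[ℝ] F}
    (hL : Function.Surjective L) : ∃ K : F →L[ℝ] E, ∀ y, L (K y) = y := by
  obtain ⟨K, hK⟩ := L.toLinearMap.exists_rightInverse_of_surjective (LinearMap.range_eq_top.2 hL)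
  exact ⟨LinearMap.toContinuousLinearMap K, fun y => LinearMap.congr_fun hK y⟩

/-- A submersion remains one at nearby points. -/
theorem eventually_surjective_fderiv {E F : Type*} [NormedAddCommGroup E] [NormedSpace ℝ E]
    [NormedAddCommGroup F] [NormedSpace ℝ F] [FiniteDimensional ℝ F] {G : E → F} {x : E}
    (hG : ContDiffAt ℝ 1 G x) (hsurj : Function.Surjective (fderiv ℝ G x)) :
    ∀ᶠ y in 𝓝 x, Function.Surjective (fderiv ℝ G y) := by
  obtain ⟨K, hK⟩ := exists_continuous_rightInverse hsurj
  have : CompleteSpace F := FiniteDimensional.complete ℝ F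
  have hcont : ContinuousAt (fun y => (fderiv ℝ G y).comp K) x :=
    ((hG.fderiv_right (m := 0) (by norm_num)).continuousAt).clm_comp continuousAt_const
  have hone : (fderiv ℝ G x).comp K = 1 := by
    ext y
    simpa using hK y
  have hunit : ∀ᶠ A in 𝓝 ((fderiv ℝ G x).comp K), IsUnit A := by
    rw [hone]
    exact Units.isOpen.mem_nhds isUnit_one
  filter_upwards [hcont.eventually hunit] with y hy
  obtain ⟨B, hB⟩ := hy.exists_right_inv
  exact fun z => ⟨K (B z), by simpa using congrArg (fun A : F →L[ℝ] F => A z) hB⟩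

/-- Near a point where `G` is a submersion the set `{G = 0}` is a submanifold. With a right inverse
`K` of the derivative `G'`, the map `φ y = y + K (G y - G' y)` has derivative `id`, and
`G' (φ y) = G y`, so that it carries `{G = 0}` into the kernel of `G'`. -/
theorem isSubmanifoldAt_of_submersion {E F : Type*} [NormedAddCommGroup E] [NormedSpace ℝ E]
    [FiniteDimensional ℝ E] [NormedAddCommGroup F] [NormedSpace ℝ F] [FiniteDimensional ℝ F]
    {s : WithTop ℕ∞} (hs : 1 ≤ s) (hs' : s ≠ ∞) {G : E → F} {x : E} (hG : ContDiffAt ℝ s G x)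
    (hsurj : Function.Surjective (fderiv ℝ G x)) {M : Set E}
    (hM : ∀ᶠ y in 𝓝 x, y ∈ M ↔ G y = 0) :
    IsSubmanifoldAt s (Module.finrank ℝ E - Module.finrank ℝ F) M x := by
  have : CompleteSpace E := FiniteDimensional.complete ℝ E
  have hs0 : s ≠ 0 := (zero_lt_one.trans_le hs).ne'
  obtain ⟨K, hK⟩ := exists_continuous_rightInverse hsurj
  set L := fderiv ℝ G x with hL
  let ψ : E → E := fun y => y + K (G y - L y)
  have hψ : ContDiffAt ℝ s ψ x :=
    contDiffAt_id.add (K.contDiff.contDiffAt.comp x (hG.sub L.contDiff.contDiffAt))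
  have hψ' : HasFDerivAt ψ ((ContinuousLinearEquiv.refl ℝ E : E ≃L[ℝ] E) : E →L[ℝ] E) x := by
    have h1 : HasFDerivAt G L x := (hG.differentiableAt hs0).hasFDerivAt
    have h2 := (hasFDerivAt_id x).add (K.hasFDerivAt.comp x (h1.sub L.hasFDerivAt))
    refine h2.congr_fderiv ?_
    ext v
    simp
  let e := hψ.toOpenPartialHomeomorph ψ hψ' hs0
  have hxe : x ∈ e.source := hψ.mem_toOpenPartialHomeomorph_source hψ' hs0
  have hsymm : ContDiffAt ℝ s e.symm (e x) := hψ.to_localInverse hψ' hs0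
  have hev : ∀ᶠ y in 𝓝 x, ContDiffAt ℝ s ψ y ∧ ContDiffAt ℝ s e.symm (e y) ∧
      (y ∈ M ↔ G y = 0) :=
    (hψ.eventually hs').and
      (((e.continuousAt hxe).eventually (hsymm.eventually hs')).and hM)
  obtain ⟨N, hN, hNo, hxN⟩ := eventually_nhds_iff.1 hev
  refine ⟨e.restrOpen N hNo, LinearMap.ker L.toLinearMap, ⟨hxe, hxN⟩, ?_, ?_, ?_, ?_⟩
  · exact fun y hy => (hN y hy.2).1.contDiffWithinAt
  · intro z hz
    have hz1 : z ∈ e.target := hz.1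
    have hz2 : e.symm z ∈ N := hz.2
    have := (hN _ hz2).2.1
    rw [e.right_inv hz1] at this
    exact this.contDiffWithinAt
  · have h1 := L.toLinearMap.finrank_range_add_finrank_ker
    rw [LinearMap.range_eq_top.2 hsurj, finrank_top] at h1
    omega
  · intro y hy
    have h1 : L (ψ y) = G y := by simp [ψ, hK]
    have h2 : (e.restrOpen N hNo) y = ψ y := rfl
    rw [h2, (hN y hy.2).2.2, SetLike.mem_coe, LinearMap.mem_ker, ContinuousLinearMap.coe_coe, h1]

/-- Transport of a submanifold by a homeomorphism yields a locally flat topological submanifold. -/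
theorem IsSubmanifoldAt.of_preimage_homeomorph {E : Type*} [NormedAddCommGroup E]
    [NormedSpace ℝ E] {d : ℕ} {M : Set E} {x : E} (h : E ≃ₜ E)
    (hM : IsSubmanifoldAt 0 d (h ⁻¹' M) x) : IsSubmanifoldAt 0 d M (h x) := by
  obtain ⟨φ, W, hx, -, -, hW, hI⟩ := hM
  refine ⟨h.symm.toOpenPartialHomeomorph.trans φ, W, ?_, ?_, ?_, hW, ?_⟩
  · simpa using hx
  · exact contDiffOn_zero.2 (OpenPartialHomeomorph.continuousOn _)
  · exact contDiffOn_zero.2 (OpenPartialHomeomorph.continuousOn_symm _)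
  · intro y hy
    have hy' : h.symm y ∈ φ.source := by simpa using hy
    simpa using hI hy'

/-! ### The functions `w ^ a * conj w ^ b` -/

/-- The function `w ↦ w ^ a * w̄ ^ b` with integral exponents. For `a + b ≥ 1` it is continuous with
value `0` at the origin, also if one exponent is negative. -/
noncomputable def mixedPow (a b : ℤ) (w : ℂ) : ℂ := w ^ a * conj w ^ b

theorem mixedPow_zero_exponents (w : ℂ) : mixedPow 0 0 w = 1 := by simp [mixedPow]

theorem mixedPow_ne_zero {a b : ℤ} {w : ℂ} (hw : w ≠ 0) : mixedPow a b w ≠ 0 :=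
  mul_ne_zero (zpow_ne_zero _ hw) (zpow_ne_zero _ ((map_ne_zero _).2 hw))

theorem mixedPow_add {a b a' b' : ℤ} {w : ℂ} (hw : w ≠ 0) :
    mixedPow (a + a') (b + b') w = mixedPow a b w * mixedPow a' b' w := by
  simp only [mixedPow]
  rw [zpow_add₀ hw, zpow_add₀ ((map_ne_zero _).2 hw)]
  ring

theorem mixedPow_apply_zero {a b : ℤ} (h : 1 ≤ a + b) : mixedPow a b 0 = 0 := by
  by_cases ha : a = 0
  · have hb : b ≠ 0 := by omega
    simp [mixedPow, zero_zpow b hb]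
  · simp [mixedPow, zero_zpow a ha]

theorem norm_mixedPow {a b : ℤ} (h : 1 ≤ a + b) (w : ℂ) :
    ‖mixedPow a b w‖ = ‖w‖ ^ (a + b).toNat := by
  by_cases hw : w = 0
  · rw [hw, mixedPow_apply_zero h, norm_zero, zero_pow (by omega)]
  · rw [mixedPow, norm_mul, norm_zpow, norm_zpow, RCLike.norm_conj,
      ← zpow_add₀ (norm_ne_zero_iff.2 hw), ← zpow_natCast, Int.toNat_of_nonneg (by omega)]

theorem contDiffAt_conj {s : WithTop ℕ∞} (w : ℂ) : ContDiffAt ℝ s (fun w : ℂ => conj w) w :=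
  Complex.conjCLE.contDiff.contDiffAt

theorem contDiffAt_zpow {s : WithTop ℕ∞} {E : Type*} [NormedAddCommGroup E] [NormedSpace ℝ E]
    {g : E → ℂ} {x : E} (hg : ContDiffAt ℝ s g x) (hx : g x ≠ 0) (a : ℤ) :
    ContDiffAt ℝ s (fun y => g y ^ a) x := by
  cases a with
  | ofNat k => simpa using hg.pow k
  | negSucc k =>
    simp only [zpow_negSucc]
    exact (hg.pow (k + 1)).inv (pow_ne_zero _ hx)

theorem contDiffAt_mixedPow {s : WithTop ℕ∞} (a b : ℤ) {w : ℂ} (hw : w ≠ 0) :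
    ContDiffAt ℝ s (mixedPow a b) w :=
  (contDiffAt_zpow contDiffAt_id hw a).mul
    (contDiffAt_zpow (contDiffAt_conj w) ((map_ne_zero _).2 hw) b)

theorem continuous_mixedPow {a b : ℤ} (h : 1 ≤ a + b) : Continuous (mixedPow a b) := by
  refine continuous_iff_continuousAt.2 fun w => ?_
  by_cases hw : w = 0
  · subst hw
    rw [ContinuousAt, mixedPow_apply_zero h, tendsto_zero_iff_norm_tendsto_zero]
    simp only [norm_mixedPow h]
    have : Continuous fun w : ℂ => ‖w‖ ^ (a + b).toNat := by fun_prop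
    simpa [zero_pow (show (a + b).toNat ≠ 0 by omega)] using this.tendsto 0
  · exact (contDiffAt_mixedPow (s := 0) a b hw).continuousAt

/-- The derivative of `w ^ a * w̄ ^ b`, at the origin too if `a + b ≥ 2`. -/
theorem hasFDerivAt_mixedPow {a b : ℤ} (h : 2 ≤ a + b) (w : ℂ) :
    HasFDerivAt (mixedPow a b)
      (mixedPow (a - 1) b w • ((a : ℂ) • ContinuousLinearMap.id ℝ ℂ) +
        mixedPow a (b - 1) w • ((b : ℂ) • (Complex.conjCLE : ℂ →L[ℝ] ℂ))) w := by
  by_cases hw : w = 0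
  · subst hw
    rw [mixedPow_apply_zero (by omega), mixedPow_apply_zero (by omega)]
    refine HasFDerivAt.congr_fderiv (f' := 0)
      (Asymptotics.IsBigO.hasFDerivAt (n := (a + b).toNat) ?_ (by omega)) (by ext v; simp)
    refine Asymptotics.IsBigO.of_bound 1 (Filter.Eventually.of_forall fun y => ?_)
    rw [norm_mixedPow (by omega)]
    simp
  · have hw' : conj w ≠ 0 := (map_ne_zero _).2 hw
    have h1 : HasFDerivAt (fun w : ℂ => w ^ a)
        ((((a : ℂ) * w ^ (a - 1)) • ContinuousLinearMap.id ℝ ℂ) : ℂ →L[ℝ] ℂ) w := by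
      refine ((hasDerivAt_zpow a w (Or.inl hw)).hasFDerivAt.restrictScalars ℝ).congr_fderiv ?_
      ext v; simp [mul_comm]
    have h2 : HasFDerivAt (fun w : ℂ => conj w ^ b)
        ((((b : ℂ) * conj w ^ (b - 1)) • (Complex.conjCLE : ℂ →L[ℝ] ℂ))) w := by
      have h3 := ((hasDerivAt_zpow b (conj w) (Or.inl hw')).hasFDerivAt.restrictScalars ℝ).comp w
        (Complex.conjCLE : ℂ →L[ℝ] ℂ).hasFDerivAt
      refine h3.congr_fderiv ?_
      ext v; simp [mul_comm]
    refine (h1.mul h2).congr_fderiv ?_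
    ext v
    simp [mixedPow]
    ring

/-- `w ^ a * w̄ ^ b` is homogeneous of degree `a + b`, hence of class `C^{a+b-1}`. -/
theorem contDiff_mixedPow (k : ℕ) {a b : ℤ} (h : (k : ℤ) + 1 ≤ a + b) :
    ContDiff ℝ k (mixedPow a b) := by
  induction k generalizing a b with
  | zero => exact contDiff_zero.2 (continuous_mixedPow (by simpa using h))
  | succ k ih =>
    push_cast at h
    rw [Nat.cast_succ]
    refine contDiff_succ_iff_hasFDerivAt.2 ⟨_, ?_, hasFDerivAt_mixedPow (by omega)⟩
    exact ((ih (by omega)).smul contDiff_const).add ((ih (by omega)).smul contDiff_const)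

/-! ### Radial reparametrization -/

/-- The homeomorphism `w ↦ |w|² w` of the plane. Composition with it multiplies the degree of
`w ^ a * w̄ ^ b` by three, so that the merely continuous ones become differentiable. -/
noncomputable def radialCube : ℂ ≃ₜ ℂ where
  toFun w := (‖w‖ ^ 2 : ℝ) • w
  invFun w := (‖w‖ ^ (-(2 / 3) : ℝ)) • w
  left_inv w := by
    by_cases hw : w = 0
    · simp [hw]
    · have h0 : 0 < ‖w‖ := norm_pos_iff.2 hw
      have h1 : ‖(‖w‖ ^ 2 : ℝ) • w‖ = ‖w‖ ^ (3 : ℝ) := by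
        rw [norm_smul, norm_pow, norm_norm]
        norm_cast
      dsimp only
      rw [h1, ← Real.rpow_mul h0.le, smul_smul, ← Real.rpow_natCast, ← Real.rpow_add h0]
      norm_num
  right_inv w := by
    by_cases hw : w = 0
    · simp [hw]
    · have h0 : 0 < ‖w‖ := norm_pos_iff.2 hw
      have h1 : ‖(‖w‖ ^ (-(2 / 3) : ℝ)) • w‖ = ‖w‖ ^ (1 / 3 : ℝ) := by
        rw [norm_smul, Real.norm_of_nonneg (by positivity)]
        nth_rw 2 [← Real.rpow_one ‖w‖]
        rw [← Real.rpow_add h0]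
        norm_num
      dsimp only
      rw [h1, ← Real.rpow_natCast, ← Real.rpow_mul h0.le, smul_smul, ← Real.rpow_add h0]
      norm_num
  continuous_toFun := by fun_prop
  continuous_invFun := by
    refine continuous_iff_continuousAt.2 fun w => ?_
    by_cases hw : w = 0
    · subst hw
      rw [ContinuousAt, smul_zero, tendsto_zero_iff_norm_tendsto_zero]
      have h1 : ∀ w : ℂ, ‖(‖w‖ ^ (-(2 / 3) : ℝ)) • w‖ = ‖w‖ ^ (1 / 3 : ℝ) := fun w => by
        by_cases hw : w = 0
        · rw [hw]; norm_num
        have h0 : 0 < ‖w‖ := norm_pos_iff.2 hw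
        rw [norm_smul, Real.norm_of_nonneg (by positivity)]
        nth_rw 2 [← Real.rpow_one ‖w‖]
        rw [← Real.rpow_add h0]
        norm_num
      simp only [h1]
      have : Continuous fun w : ℂ => ‖w‖ ^ (1 / 3 : ℝ) :=
        continuous_norm.rpow_const fun _ => Or.inr (by norm_num)
      simpa using this.tendsto 0
    · exact (continuousAt_id.norm.rpow_const (Or.inl (norm_ne_zero_iff.2 hw))).smul continuousAt_id

theorem radialCube_apply (w : ℂ) : radialCube w = w ^ 2 * conj w := by
  change (‖w‖ ^ 2 : ℝ) • w = _
  rw [Complex.real_smul, Complex.ofReal_pow, ← Complex.mul_conj']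
  ring

theorem radialCube_eq_zero {w : ℂ} : radialCube w = 0 ↔ w = 0 := by
  simp [radialCube_apply]

theorem mixedPow_radialCube {a b : ℤ} (h : (a = 0 ∧ b = 0) ∨ 1 ≤ a + b) (w : ℂ) :
    mixedPow a b (radialCube w) = mixedPow (2 * a + b) (a + 2 * b) w := by
  by_cases hw : w = 0
  · subst hw
    rw [radialCube_eq_zero.2 rfl]
    rcases h with ⟨rfl, rfl⟩ | h
    · simp
    · rw [mixedPow_apply_zero h, mixedPow_apply_zero (by omega)]
  · have hw' : conj w ≠ 0 := (map_ne_zero _).2 hw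
    simp only [mixedPow, radialCube_apply, map_mul, map_pow, Complex.conj_conj]
    rw [mul_zpow, mul_zpow, zpow_add₀ hw, zpow_add₀ hw', zpow_mul, zpow_mul]
    norm_cast
    ring

/-! ### Mixed Laurent polynomials along a coordinate subspace -/

/-- The mixed Laurent polynomial `∑ c_m ∏ u_j ^ α_{m,j} * ū_j ^ β_{m,j}`. -/
noncomputable def mixedLaurent {ι M : Type*} [Fintype ι] (s : Finset M) (c : M → ℂ)
    (α β : M → ι → ℤ) (u : ι → ℂ) : ℂ :=
  ∑ m ∈ s, c m * ∏ j, mixedPow (α m j) (β m j) (u j)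

open Classical in
/-- The terms in which the variables `u_j`, `j ∈ T`, do not occur. -/
noncomputable def initialTerms {ι M : Type*} (s : Finset M) (α β : M → ι → ℤ) (T : Finset ι) :
    Finset M :=
  s.filter fun m => ∀ j ∈ T, α m j = 0 ∧ β m j = 0

theorem mem_initialTerms {ι M : Type*} {s : Finset M} {α β : M → ι → ℤ} {T : Finset ι} {m : M} :
    m ∈ initialTerms s α β T ↔ m ∈ s ∧ ∀ j ∈ T, α m j = 0 ∧ β m j = 0 := by
  classical
  simp [initialTerms]

theorem contDiffAt_mixedLaurent {ι M : Type*} [Fintype ι] {r : WithTop ℕ∞} {s : Finset M}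
    {c : M → ℂ} {α β : M → ι → ℤ} {u : ι → ℂ}
    (h : ∀ m ∈ s, ∀ j, u j ≠ 0 ∨ ContDiff ℝ r (mixedPow (α m j) (β m j))) :
    ContDiffAt ℝ r (mixedLaurent s c α β) u := by
  refine ContDiffAt.sum fun m hm => contDiffAt_const.mul (contDiffAt_prod fun j _ => ?_)
  have hj : ContDiffAt ℝ r (fun u : ι → ℂ => u j) u :=
    (ContinuousLinearMap.proj (R := ℝ) (φ := fun _ : ι => ℂ) j).contDiff.contDiffAt
  refine ContDiffAt.comp (g := mixedPow (α m j) (β m j)) u ?_ hj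
  rcases h m hm j with h | h
  · exact contDiffAt_mixedPow _ _ h
  · exact h.contDiffAt

theorem contDiff_mixedPow_of_eq_zero {r : WithTop ℕ∞} {a b : ℤ} (h : a = 0 ∧ b = 0) :
    ContDiff ℝ r (mixedPow a b) := by
  obtain ⟨rfl, rfl⟩ := h
  rw [show mixedPow 0 0 = fun _ => (1 : ℂ) from funext mixedPow_zero_exponents]
  exact contDiff_const

theorem contDiffAt_initial {ι M : Type*} [Fintype ι] {r : WithTop ℕ∞} {s : Finset M}
    {c : M → ℂ} {α β : M → ι → ℤ} {T : Finset ι} {u : ι → ℂ} (hu : ∀ j, j ∉ T → u j ≠ 0) :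
    ContDiffAt ℝ r (mixedLaurent (initialTerms s α β T) c α β) u := by
  refine contDiffAt_mixedLaurent fun m hm j => ?_
  by_cases hj : j ∈ T
  · exact Or.inr (contDiff_mixedPow_of_eq_zero ((mem_initialTerms.1 hm).2 j hj))
  · exact Or.inl (hu j hj)

/-- The sum of the initial terms depends only on the coordinates outside `T`. -/
theorem initial_congr {ι M : Type*} [Fintype ι] {s : Finset M} {c : M → ℂ} {α β : M → ι → ℤ}
    {T : Finset ι} {u v : ι → ℂ} (h : ∀ j, j ∉ T → u j = v j) :
    mixedLaurent (initialTerms s α β T) c α β u =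
      mixedLaurent (initialTerms s α β T) c α β v := by
  refine Finset.sum_congr rfl fun m hm => congrArg _ (Finset.prod_congr rfl fun j _ => ?_)
  by_cases hj : j ∈ T
  · obtain ⟨h1, h2⟩ := (mem_initialTerms.1 hm).2 j hj
    rw [h1, h2, mixedPow_zero_exponents, mixedPow_zero_exponents]
  · rw [h j hj]

theorem fderiv_initial_congr {ι M : Type*} [Fintype ι] {s : Finset M} {c : M → ℂ}
    {α β : M → ι → ℤ} {T : Finset ι} {u v : ι → ℂ} (h : ∀ j, j ∉ T → u j = v j) :
    fderiv ℝ (mixedLaurent (initialTerms s α β T) c α β) u =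
      fderiv ℝ (mixedLaurent (initialTerms s α β T) c α β) v := by
  have h1 := fderiv_comp_add_right (𝕜 := ℝ) (f := mixedLaurent (initialTerms s α β T) c α β)
    (x := u) (v - u)
  rw [add_sub_cancel] at h1
  rw [← h1]
  congr 1
  funext w
  exact initial_congr fun j hj => by simp [h j hj]

/-- All terms other than the initial ones vanish on the subspace `u_T = 0`. -/
theorem mixedLaurent_eq_initial {ι M : Type*} [Fintype ι] {s : Finset M} {c : M → ℂ}
    {α β : M → ι → ℤ} {T : Finset ι}
    (hdeg : ∀ m ∈ s, ∀ j ∈ T, (α m j = 0 ∧ β m j = 0) ∨ 1 ≤ α m j + β m j) {u : ι → ℂ}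
    (hu : ∀ j ∈ T, u j = 0) :
    mixedLaurent s c α β u = mixedLaurent (initialTerms s α β T) c α β u := by
  refine (Finset.sum_subset (fun m hm => (mem_initialTerms.1 hm).1) fun m hm hm' => ?_).symm
  have : ∃ j ∈ T, ¬(α m j = 0 ∧ β m j = 0) := by
    by_contra! h
    exact hm' (mem_initialTerms.2 ⟨hm, fun j hj => h j hj⟩)
  obtain ⟨j, hj, hne⟩ := this
  rw [Finset.prod_eq_zero (Finset.mem_univ j), mul_zero]
  rw [hu j hj, mixedPow_apply_zero ((hdeg m hm j hj).resolve_left hne)]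

/-- The restriction of the coordinates to `T` together with a function. -/
def withCoordinates {ι : Type*} (T : Finset ι) (F : (ι → ℂ) → ℂ) (u : ι → ℂ) : (T → ℂ) × ℂ :=
  (fun j => u j, F u)

theorem hasFDerivAt_withCoordinates {ι : Type*} [Fintype ι] (T : Finset ι) {F : (ι → ℂ) → ℂ}
    {u : ι → ℂ} (hF : DifferentiableAt ℝ F u) :
    HasFDerivAt (withCoordinates T F)
      ((ContinuousLinearMap.pi fun j : T =>
        ContinuousLinearMap.proj (R := ℝ) (φ := fun _ : ι => ℂ) (j : ι)).prod (fderiv ℝ F u)) u :=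
  (ContinuousLinearMap.pi fun j : T =>
    ContinuousLinearMap.proj (R := ℝ) (φ := fun _ : ι => ℂ) (j : ι)).hasFDerivAt.prodMk
      hF.hasFDerivAt

theorem contDiffAt_withCoordinates {ι : Type*} [Fintype ι] (T : Finset ι) {r : WithTop ℕ∞}
    {F : (ι → ℂ) → ℂ} {u : ι → ℂ} (hF : ContDiffAt ℝ r F u) :
    ContDiffAt ℝ r (withCoordinates T F) u :=
  (ContinuousLinearMap.pi fun j : T =>
    ContinuousLinearMap.proj (R := ℝ) (φ := fun _ : ι => ℂ) (j : ι)).contDiff.contDiffAt.prodMk hF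

/-- Let `F` agree on the subspace `u_T = 0` with a function `F₀` that does not depend on `u_T` and
is a submersion. Then `(u_T, F)` is a submersion. -/
theorem surjective_fderiv_withCoordinates {ι : Type*} [Fintype ι] {T : Finset ι}
    {F F₀ : (ι → ℂ) → ℂ} {u : ι → ℂ} (hu : ∀ j ∈ T, u j = 0)
    (hF : DifferentiableAt ℝ F u) (hF₀ : DifferentiableAt ℝ F₀ u)
    (hinv : ∀ v w : ι → ℂ, (∀ j, j ∉ T → v j = w j) → F₀ v = F₀ w)
    (heq : ∀ v : ι → ℂ, (∀ j ∈ T, v j = 0) → F v = F₀ v)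
    (hsurj : Function.Surjective (fderiv ℝ F₀ u)) :
    Function.Surjective (fderiv ℝ (withCoordinates T F) u) := by
  classical
  rw [(hasFDerivAt_withCoordinates T hF).fderiv]
  have h1 : ∀ v : ι → ℂ, (∀ j ∈ T, v j = 0) → fderiv ℝ F u v = fderiv ℝ F₀ u v := fun v hv => by
    rw [← hF.lineDeriv_eq_fderiv, ← hF₀.lineDeriv_eq_fderiv, lineDeriv, lineDeriv]
    congr 1
    funext t
    exact heq _ fun j hj => by simp [hu j hj, hv j hj]
  have h2 : ∀ v : ι → ℂ, (∀ j, j ∉ T → v j = 0) → fderiv ℝ F₀ u v = 0 := fun v hv => by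
    rw [← hF₀.lineDeriv_eq_fderiv, lineDeriv]
    have : (fun t : ℝ => F₀ (u + t • v)) = fun _ => F₀ u := funext fun t =>
      hinv _ _ fun j hj => by simp [hv j hj]
    rw [this, deriv_const]
  rintro ⟨w, y⟩
  let v₀ : ι → ℂ := fun j => if hj : j ∈ T then w ⟨j, hj⟩ else 0
  obtain ⟨v, hv⟩ := hsurj (y - fderiv ℝ F u v₀)
  let v₁ : ι → ℂ := fun j => if j ∈ T then 0 else v j
  have hv₁ : fderiv ℝ F u v₁ = y - fderiv ℝ F u v₀ := by
    rw [h1 v₁ fun j hj => by simp [v₁, hj], ← hv, ← sub_eq_zero, ← map_sub]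
    exact h2 _ fun j hj => by simp [v₁, hj]
  refine ⟨v₀ + v₁, Prod.ext (funext fun j => ?_) ?_⟩
  · simp [v₀, v₁]
  · simp only [ContinuousLinearMap.prod_apply]
    rw [map_add, hv₁]
    abel

/-- If `(u_T, F)` is a submersion, the zeros of `F` with all `u_j ≠ 0`, `j ∈ T`, are dense in the
zeros of `F`, because the values of `u_T` can be prescribed on `{F = 0}`. -/
theorem eventually_mem_closure_of_submersion {ι : Type*} [Fintype ι] {T : Finset ι}
    {F : (ι → ℂ) → ℂ} {u₀ : ι → ℂ} (hF : ContDiffAt ℝ 1 F u₀)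
    (hsurj : Function.Surjective (fderiv ℝ (withCoordinates T F) u₀)) :
    ∀ᶠ u in 𝓝 u₀, F u = 0 → u ∈ closure {v | F v = 0 ∧ ∀ j ∈ T, v j ≠ 0} := by
  have hG := contDiffAt_withCoordinates T hF
  filter_upwards [eventually_surjective_fderiv hG hsurj, hG.eventually (by simp)] with u hu hGu h0
  have hmap := (hGu.hasStrictFDerivAt one_ne_zero).map_nhds_eq_of_surj (LinearMap.range_eq_top.2 hu)
  refine mem_closure_iff_nhds.2 fun U hU => ?_
  have hUG : withCoordinates T F '' U ∈ 𝓝 (withCoordinates T F u) := by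
    rw [← hmap]
    exact Filter.image_mem_map hU
  have hslice : ∀ᶠ w in 𝓝 (fun j : T => u j), (w, (0 : ℂ)) ∈ withCoordinates T F '' U := by
    have hc : Continuous fun w : T → ℂ => (w, (0 : ℂ)) := by fun_prop
    have := hc.tendsto (fun j : T => u j)
    rw [← h0] at this ⊢
    exact this hUG
  have hdense : Dense (Set.pi Set.univ fun _ : T => ({0}ᶜ : Set ℂ)) :=
    dense_pi _ fun _ _ => dense_compl_singleton 0
  obtain ⟨w, ⟨v, hvU, hv⟩, hw⟩ := mem_closure_iff_nhds.1 (hdense fun j : T => u j) _ hslice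
  refine ⟨v, hvU, congrArg Prod.snd hv, fun j hj => ?_⟩
  have h1 : v j = w ⟨j, hj⟩ := congrFun (congrArg Prod.fst hv) ⟨j, hj⟩
  rw [h1]
  exact hw ⟨j, hj⟩ trivial

open Classical in
/-- The homeomorphism `w ↦ |w|² w` on the coordinates in `T`, the identity on the others. -/
noncomputable def cubeOn {ι : Type*} (T : Finset ι) : (ι → ℂ) ≃ₜ (ι → ℂ) :=
  Homeomorph.piCongrRight fun j => if j ∈ T then radialCube else Homeomorph.refl ℂ

theorem cubeOn_apply_of_mem {ι : Type*} {T : Finset ι} {j : ι} (hj : j ∈ T) (u : ι → ℂ) :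
    cubeOn T u j = radialCube (u j) := by
  simp [cubeOn, hj]

theorem cubeOn_apply_of_notMem {ι : Type*} {T : Finset ι} {j : ι} (hj : j ∉ T) (u : ι → ℂ) :
    cubeOn T u j = u j := by
  simp [cubeOn, hj]

theorem cubeOn_apply_eq_zero {ι : Type*} {T : Finset ι} {j : ι} {u : ι → ℂ} :
    cubeOn T u j = 0 ↔ u j = 0 := by
  by_cases hj : j ∈ T
  · rw [cubeOn_apply_of_mem hj, radialCube_eq_zero]
  · rw [cubeOn_apply_of_notMem hj]

theorem cubeOn_eq_self {ι : Type*} {T : Finset ι} {u : ι → ℂ} (hu : ∀ j ∈ T, u j = 0) :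
    cubeOn T u = u := by
  funext j
  by_cases hj : j ∈ T
  · rw [hu j hj, cubeOn_apply_eq_zero, hu j hj]
  · exact cubeOn_apply_of_notMem hj u

theorem differentiable_cubeOn {ι : Type*} [Fintype ι] (T : Finset ι) :
    Differentiable ℝ (cubeOn T) := by
  refine differentiable_pi.2 fun j => ?_
  have hj : Differentiable ℝ fun u : ι → ℂ => u j :=
    (ContinuousLinearMap.proj (R := ℝ) (φ := fun _ : ι => ℂ) j).differentiable
  by_cases h : j ∈ T
  · simp only [cubeOn_apply_of_mem h, radialCube_apply]
    exact (hj.pow 2).mul (Complex.conjCLE.differentiable.comp hj)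
  · simpa only [cubeOn_apply_of_notMem h] using hj

open Classical in
/-- Composition with `cubeOn T` again gives a mixed Laurent polynomial with the same initial
terms. -/
theorem mixedLaurent_cubeOn {ι M : Type*} [Fintype ι] {s : Finset M} {c : M → ℂ}
    {α β : M → ι → ℤ} {T : Finset ι}
    (hdeg : ∀ m ∈ s, ∀ j ∈ T, (α m j = 0 ∧ β m j = 0) ∨ 1 ≤ α m j + β m j) (u : ι → ℂ) :
    mixedLaurent s c α β (cubeOn T u) =
      mixedLaurent s c (fun m j => if j ∈ T then 2 * α m j + β m j else α m j)
        (fun m j => if j ∈ T then α m j + 2 * β m j else β m j) u := by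
  refine Finset.sum_congr rfl fun m hm => congrArg _ (Finset.prod_congr rfl fun j _ => ?_)
  by_cases hj : j ∈ T
  · simp only [hj, if_true]
    rw [cubeOn_apply_of_mem hj, mixedPow_radialCube (hdeg m hm j hj)]
  · simp only [hj, if_false]
    rw [cubeOn_apply_of_notMem hj]

theorem contDiffAt_mixedLaurent_cubeOn {ι M : Type*} [Fintype ι] {s : Finset M} {c : M → ℂ}
    {α β : M → ι → ℤ} {T : Finset ι}
    (hdeg : ∀ m ∈ s, ∀ j ∈ T, (α m j = 0 ∧ β m j = 0) ∨ 1 ≤ α m j + β m j) {u : ι → ℂ}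
    (hu : ∀ j, j ∉ T → u j ≠ 0) :
    ContDiffAt ℝ 1 (fun w => mixedLaurent s c α β (cubeOn T w)) u := by
  classical
  simp only [mixedLaurent_cubeOn hdeg]
  refine contDiffAt_mixedLaurent fun m hm j => ?_
  by_cases hj : j ∈ T
  · simp only [hj, if_true]
    rcases hdeg m hm j hj with h | h
    · exact Or.inr (contDiff_mixedPow_of_eq_zero (by omega))
    · exact Or.inr (contDiff_mixedPow 1 (by push_cast; omega))
  · exact Or.inl (hu j hj)

theorem finrank_real_pi (ι : Type*) [Fintype ι] :
    Module.finrank ℝ (ι → ℂ) = 2 * Fintype.card ι := by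
  rw [Module.finrank_pi_fintype]
  simp [Complex.finrank_real_complex, mul_comm]

/-- The situation near a point `u₀` with `u_T = 0` of the zero set of a mixed Laurent polynomial
whose non-initial terms have positive degree in the coordinates in `T`, and whose initial part is a
submersion at `u₀`. -/
structure IsTransversal {ι M : Type*} [Fintype ι] (s : Finset M) (c : M → ℂ) (α β : M → ι → ℤ)
    (T : Finset ι) (u₀ : ι → ℂ) : Prop where
  eq_zero : ∀ j ∈ T, u₀ j = 0
  ne_zero : ∀ j, j ∉ T → u₀ j ≠ 0
  deg : ∀ m ∈ s, ∀ j ∈ T, (α m j = 0 ∧ β m j = 0) ∨ 1 ≤ α m j + β m j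
  surjective : Function.Surjective (fderiv ℝ (mixedLaurent (initialTerms s α β T) c α β) u₀)

namespace IsTransversal

variable {ι M : Type*} [Fintype ι] {s : Finset M} {c : M → ℂ} {α β : M → ι → ℤ} {T : Finset ι}
  {u₀ : ι → ℂ}

theorem surjective_withCoordinates (h : IsTransversal s c α β T u₀) {F : (ι → ℂ) → ℂ}
    (hF : DifferentiableAt ℝ F u₀)
    (heq : ∀ v : ι → ℂ, (∀ j ∈ T, v j = 0) → F v = mixedLaurent s c α β v) :
    Function.Surjective (fderiv ℝ (withCoordinates T F) u₀) :=
  surjective_fderiv_withCoordinates h.eq_zero hF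
    ((contDiffAt_initial (r := 1) h.ne_zero).differentiableAt one_ne_zero)
    (fun _ _ hvw => initial_congr hvw)
    (fun v hv => (heq v hv).trans (mixedLaurent_eq_initial h.deg hv)) h.surjective

theorem surjective_fderiv (h : IsTransversal s c α β T u₀) {F : (ι → ℂ) → ℂ}
    (hF : DifferentiableAt ℝ F u₀)
    (heq : ∀ v : ι → ℂ, (∀ j ∈ T, v j = 0) → F v = mixedLaurent s c α β v) :
    Function.Surjective (fderiv ℝ F u₀) := by
  have h1 := h.surjective_withCoordinates hF heq
  rw [(hasFDerivAt_withCoordinates T hF).fderiv] at h1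
  intro y
  obtain ⟨v, hv⟩ := h1 (0, y)
  exact ⟨v, congrArg Prod.snd hv⟩

theorem cubeOn_base (h : IsTransversal s c α β T u₀) : cubeOn T u₀ = u₀ :=
  cubeOn_eq_self h.eq_zero

theorem contDiffAt_cubeOn (h : IsTransversal s c α β T u₀) :
    ContDiffAt ℝ 1 (fun w => mixedLaurent s c α β (cubeOn T w)) u₀ :=
  contDiffAt_mixedLaurent_cubeOn h.deg h.ne_zero

/-- Near `u₀` the zeros with all `u_j ≠ 0`, `j ∈ T`, are dense in the zeros. -/
theorem eventually_mem_closure (h : IsTransversal s c α β T u₀) :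
    ∀ᶠ u in 𝓝 u₀, mixedLaurent s c α β u = 0 →
      u ∈ closure {v | mixedLaurent s c α β v = 0 ∧ ∀ j ∈ T, v j ≠ 0} := by
  have hsurj := h.surjective_withCoordinates (h.contDiffAt_cubeOn.differentiableAt one_ne_zero)
    fun v hv => by rw [cubeOn_eq_self hv]
  have hev := eventually_mem_closure_of_submersion h.contDiffAt_cubeOn hsurj
  have ht : Filter.Tendsto (cubeOn T).symm (𝓝 u₀) (𝓝 u₀) := by
    have := (cubeOn T).symm.continuous.tendsto u₀
    rwa [(cubeOn T).symm_apply_eq.2 h.cubeOn_base.symm] at this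
  filter_upwards [ht.eventually hev] with u hu h0
  rw [(cubeOn T).apply_symm_apply] at hu
  have h1 := mem_closure_image (cubeOn T).continuous.continuousAt (hu h0)
  rw [(cubeOn T).apply_symm_apply] at h1
  refine closure_mono ?_ h1
  rintro _ ⟨v, ⟨hv, hne⟩, rfl⟩
  exact ⟨hv, fun j hj h => hne j hj (cubeOn_apply_eq_zero.1 h)⟩

/-- After the radial reparametrization the function is a submersion near `u₀`. -/
theorem eventually_surjective_cubeOn (h : IsTransversal s c α β T u₀) :
    ∀ᶠ u in 𝓝 u₀, Function.Surjective
      (fderiv ℝ (fun w => mixedLaurent s c α β (cubeOn T w)) ((cubeOn T).symm u)) := by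
  have ht : Filter.Tendsto (cubeOn T).symm (𝓝 u₀) (𝓝 u₀) := by
    have := (cubeOn T).symm.continuous.tendsto u₀
    rwa [(cubeOn T).symm_apply_eq.2 h.cubeOn_base.symm] at this
  exact ht.eventually (eventually_surjective_fderiv h.contDiffAt_cubeOn
    (h.surjective_fderiv (h.contDiffAt_cubeOn.differentiableAt one_ne_zero)
      fun v hv => by rw [cubeOn_eq_self hv]))

/-- The zero set is a topological submanifold: it is a `C¹`-submanifold after the radial
reparametrization. -/
theorem isSubmanifoldAt_zero (h : IsTransversal s c α β T u₀) {V : Set (ι → ℂ)}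
    (hV : ∀ᶠ u in 𝓝 u₀, u ∈ V ↔ mixedLaurent s c α β u = 0) :
    IsSubmanifoldAt 0 (2 * Fintype.card ι - 2) V u₀ := by
  have ht : Filter.Tendsto (cubeOn T) (𝓝 u₀) (𝓝 u₀) := by
    have := (cubeOn T).continuous.tendsto u₀
    rwa [h.cubeOn_base] at this
  have h1 := isSubmanifoldAt_of_submersion le_rfl (by simp) h.contDiffAt_cubeOn
    (h.surjective_fderiv (h.contDiffAt_cubeOn.differentiableAt one_ne_zero)
      fun v hv => by rw [cubeOn_eq_self hv])
    (M := cubeOn T ⁻¹' V) (ht.eventually hV)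
  rw [finrank_real_pi, Complex.finrank_real_complex] at h1
  have h2 := (h1.of_le zero_le_one).of_preimage_homeomorph
  rwa [h.cubeOn_base] at h2

theorem isSubmanifoldAt (h : IsTransversal s c α β T u₀) {r : WithTop ℕ∞} (hr : 1 ≤ r)
    (hr' : r ≠ ∞)
    (hreg : ∀ m ∈ s, ∀ j ∈ T, ContDiff ℝ r (mixedPow (α m j) (β m j))) {V : Set (ι → ℂ)}
    (hV : ∀ᶠ u in 𝓝 u₀, u ∈ V ↔ mixedLaurent s c α β u = 0) :
    IsSubmanifoldAt r (2 * Fintype.card ι - 2) V u₀ := by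
  have hF : ContDiffAt ℝ r (mixedLaurent s c α β) u₀ := contDiffAt_mixedLaurent fun m hm j => by
    by_cases hj : j ∈ T
    · exact Or.inr (hreg m hm j hj)
    · exact Or.inl (h.ne_zero j hj)
  have h1 := isSubmanifoldAt_of_submersion hr hr' hF
    (h.surjective_fderiv (hF.differentiableAt (zero_lt_one.trans_le hr).ne') fun v _ => rfl) hV
  rwa [finrank_real_pi, Complex.finrank_real_complex] at h1

/-- The intersection of the zero set with `u_T = 0` is an analytic submanifold. -/
theorem isSubmanifoldAt_stratum (h : IsTransversal s c α β T u₀) {V : Set (ι → ℂ)}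
    (hV : ∀ᶠ u in 𝓝 u₀, u ∈ V ↔ (∀ j ∈ T, u j = 0) ∧ mixedLaurent s c α β u = 0) :
    T.card + 1 ≤ Fintype.card ι ∧
      IsSubmanifoldAt ω (2 * (Fintype.card ι - T.card - 1)) V u₀ := by
  have hF : ContDiffAt ℝ ω (mixedLaurent (initialTerms s α β T) c α β) u₀ :=
    contDiffAt_initial h.ne_zero
  have hsurj := h.surjective_withCoordinates (hF.differentiableAt (by simp))
    fun v hv => (mixedLaurent_eq_initial h.deg hv).symm
  have hfin : Module.finrank ℝ ((T → ℂ) × ℂ) = 2 * T.card + 2 := by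
    rw [Module.finrank_prod, finrank_real_pi, Complex.finrank_real_complex, Fintype.card_coe]
  have h1 := isSubmanifoldAt_of_submersion (by simp) (by simp) (contDiffAt_withCoordinates T hF)
    hsurj (M := V) (by
      filter_upwards [hV] with u hu
      rw [hu, withCoordinates, Prod.mk_eq_zero]
      constructor
      · rintro ⟨h0, h1⟩
        exact ⟨funext fun j => h0 j j.2, mixedLaurent_eq_initial h.deg h0 ▸ h1⟩
      · rintro ⟨h0, h1⟩
        have h0' : ∀ j ∈ T, u j = 0 := fun j hj => congrFun h0 ⟨j, hj⟩
        exact ⟨h0', (mixedLaurent_eq_initial h.deg h0').trans h1⟩)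
  have hle : T.card + 1 ≤ Fintype.card ι := by
    have := LinearMap.finrank_le_finrank_of_surjective
      (f := (fderiv ℝ (withCoordinates T (mixedLaurent (initialTerms s α β T) c α β)) u₀ :
        (ι → ℂ) →ₗ[ℝ] (T → ℂ) × ℂ)) hsurj
    rw [hfin, finrank_real_pi] at this
    omega
  refine ⟨hle, ?_⟩
  rw [hfin, finrank_real_pi] at h1
  convert! h1 using 1
  omega

end IsTransversal

/-! ### Toric charts on the torus -/

theorem contDiff_eval {n : ℕ} (f : MixedPoly n) : ContDiff ℝ ω f.eval := by
  have hi : ∀ i : Fin n, ContDiff ℝ ω fun z : Fin n → ℂ => z i := fun i =>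
    (ContinuousLinearMap.proj (R := ℝ) (φ := fun _ : Fin n => ℂ) i).contDiff
  refine ContDiff.sum fun m _ => contDiff_const.mul ((contDiff_prod fun i _ => (hi i).pow _).mul
    (contDiff_prod fun i _ => ?_))
  exact (Complex.conjCLE.contDiff.comp (hi i)).pow _

theorem contDiff_chartProj {n : ℕ} {S : RegularSubdivision n} (σ : S.MaxCone) :
    ContDiff ℝ ω (chartProj σ) := by
  refine contDiff_pi.2 fun i => contDiff_prod fun P _ => ContDiff.pow ?_ _
  exact (ContinuousLinearMap.proj (R := ℝ)
    (φ := fun _ : {P : Fin n → ℕ // P ∈ σ.1} => ℂ) P).contDiff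

theorem differentiable_eval {n : ℕ} (f : MixedPoly n) : Differentiable ℝ f.eval :=
  (contDiff_eval f).differentiable (by simp)

theorem differentiable_chartProj {n : ℕ} {S : RegularSubdivision n} (σ : S.MaxCone) :
    Differentiable ℝ (chartProj σ) :=
  (contDiff_chartProj σ).differentiable (by simp)

theorem chartProj_apply_ne_zero {n : ℕ} {S : RegularSubdivision n} {σ : S.MaxCone}
    {u : ChartSpace σ} (hu : ∀ P, u P ≠ 0) (i : Fin n) : chartProj σ u i ≠ 0 :=
  Finset.prod_ne_zero_iff.2 fun P _ => pow_ne_zero _ (hu P)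

theorem chartProj_ne_zero {n : ℕ} (hn : n ≠ 0) {S : RegularSubdivision n} {σ : S.MaxCone}
    {u : ChartSpace σ} (hu : ∀ P, u P ≠ 0) : chartProj σ u ≠ 0 := fun h =>
  chartProj_apply_ne_zero hu ⟨0, Nat.pos_of_ne_zero hn⟩ (by rw [h]; rfl)

theorem chartProj_eq_zero {n : ℕ} {S : RegularSubdivision n} {σ : S.MaxCone} {u : ChartSpace σ}
    {P : {P : Fin n → ℕ // P ∈ σ.1}} (hP : StrictlyPositive P.1) (h : u P = 0) :
    chartProj σ u = 0 :=
  funext fun i => Finset.prod_eq_zero (Finset.mem_univ P) (by rw [h, zero_pow (hP i).ne'])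

/-- The inverse of `π_σ` on the torus. -/
noncomputable def chartInv {n : ℕ} {S : RegularSubdivision n} (σ : S.MaxCone) (z : Fin n → ℂ) :
    ChartSpace σ :=
  fun P => ∏ i, z i ^ dualBasis σ P i

theorem chartProj_chartInv {n : ℕ} {S : RegularSubdivision n} (σ : S.MaxCone) {z : Fin n → ℂ}
    (hz : ∀ i, z i ≠ 0) : chartProj σ (chartInv σ z) = z := by
  funext j
  have h1 : ∀ P : {P : Fin n → ℕ // P ∈ σ.1}, (∏ i, z i ^ dualBasis σ P i) ^ P.1 j =
      ∏ i, z i ^ (dualBasis σ P i * (P.1 j : ℤ)) := fun P => by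
    rw [← Finset.prod_pow]
    exact Finset.prod_congr rfl fun i _ => by rw [zpow_mul, zpow_natCast]
  simp only [chartProj, chartInv, h1]
  rw [Finset.prod_comm, Finset.prod_eq_single j]
  · rw [← zpow_sum_eq_prod _ _ (Or.inl (hz j)), sum_dualBasis, if_pos rfl, zpow_one]
  · intro i _ hij
    rw [← zpow_sum_eq_prod _ _ (Or.inl (hz i)), sum_dualBasis, if_neg hij, zpow_zero]
  · simp

theorem chartInv_chartProj {n : ℕ} {S : RegularSubdivision n} (σ : S.MaxCone) {u : ChartSpace σ}
    (hu : ∀ P, u P ≠ 0) : chartInv σ (chartProj σ u) = u := by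
  classical
  funext P
  have h1 : ∀ i, (∏ Q : {P : Fin n → ℕ // P ∈ σ.1}, u Q ^ Q.1 i) ^ dualBasis σ P i =
      ∏ Q, u Q ^ (dualBasis σ P i * (Q.1 i : ℤ)) := fun i => by
    rw [← Finset.prod_zpow]
    exact Finset.prod_congr rfl fun Q _ => by rw [mul_comm, zpow_mul, zpow_natCast]
  simp only [chartProj, chartInv, h1]
  have h2 : ∀ Q, ∏ i, u Q ^ (dualBasis σ P i * (Q.1 i : ℤ)) =
      u Q ^ (if P = Q then (1 : ℤ) else 0) :=
    fun Q => by
      rw [← zpow_sum_eq_prod _ _ (Or.inl (hu Q)), ← intPairing_dualBasis σ P Q, intPairing]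
  rw [Finset.prod_comm, Finset.prod_congr rfl fun Q _ => h2 Q, Finset.prod_eq_single P]
  · simp
  · intro Q _ hQ
    rw [if_neg hQ.symm, zpow_zero]
  · simp

/-- On the torus `π_σ` is a local diffeomorphism. -/
theorem surjective_fderiv_chartProj {n : ℕ} {S : RegularSubdivision n} {σ : S.MaxCone}
    {u : ChartSpace σ} (hu : ∀ P, u P ≠ 0) :
    Function.Surjective (fderiv ℝ (chartProj σ) u) := by
  have hz := chartProj_apply_ne_zero hu
  have hinv : DifferentiableAt ℝ (chartInv σ) (chartProj σ u) := by
    refine differentiableAt_pi.2 fun P => ContDiffAt.differentiableAt (n := 1) ?_ one_ne_zero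
    refine contDiffAt_prod fun i _ =>
      contDiffAt_zpow (g := fun z : Fin n → ℂ => z i) ?_ (hz i) _
    exact (ContinuousLinearMap.proj (R := ℝ) (φ := fun _ : Fin n => ℂ) i).contDiff.contDiffAt
  have hcomp : HasFDerivAt (fun z => chartProj σ (chartInv σ z))
      ((fderiv ℝ (chartProj σ) u).comp (fderiv ℝ (chartInv σ) (chartProj σ u)))
      (chartProj σ u) := by
    have hproj : HasFDerivAt (chartProj σ) (fderiv ℝ (chartProj σ) u)
        (chartInv σ (chartProj σ u)) := by
      rw [chartInv_chartProj σ hu]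
      exact (differentiable_chartProj σ u).hasFDerivAt
    exact hproj.comp (chartProj σ u) hinv.hasFDerivAt
  have hid : (fun z => chartProj σ (chartInv σ z)) =ᶠ[𝓝 (chartProj σ u)] id := by
    have : ∀ᶠ z : Fin n → ℂ in 𝓝 (chartProj σ u), ∀ i, z i ≠ 0 :=
      Filter.eventually_all.2 fun i => (continuous_apply i).continuousAt.eventually_ne (hz i)
    filter_upwards [this] with z hz
    exact chartProj_chartInv σ hz
  have h := hcomp.unique ((hasFDerivAt_id (𝕜 := ℝ) _).congr_of_eventuallyEq hid)
  intro v
  exact ⟨_, congrArg (fun L : (Fin n → ℂ) →L[ℝ] (Fin n → ℂ) => L v) h⟩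

/-- Composition with `π_σ` does not change whether a function is a submersion at a point of the
torus. -/
theorem surjective_fderiv_comp_chartProj_iff {n : ℕ} {S : RegularSubdivision n} {σ : S.MaxCone}
    {u : ChartSpace σ} (hu : ∀ P, u P ≠ 0) (g : MixedPoly n) :
    Function.Surjective (fderiv ℝ (fun u => g.eval (chartProj σ u)) u) ↔
      Function.Surjective (fderiv ℝ g.eval (chartProj σ u)) := by
  have h : fderiv ℝ (fun u => g.eval (chartProj σ u)) u =
      (fderiv ℝ g.eval (chartProj σ u)).comp (fderiv ℝ (chartProj σ) u) :=
    ((differentiable_eval g _).hasFDerivAt.comp u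
      (differentiable_chartProj σ u).hasFDerivAt).fderiv
  rw [h, ContinuousLinearMap.coe_comp]
  exact ⟨fun h => h.of_comp, fun h => h.comp (surjective_fderiv_chartProj hu)⟩

/-- At a zero of `B`, the product `A B` with `A ≠ 0` is a submersion if and only if `B` is. -/
theorem surjective_fderiv_mul_iff {E : Type*} [NormedAddCommGroup E] [NormedSpace ℝ E]
    {A B g : E → ℂ} {x : E} (hA : DifferentiableAt ℝ A x) (hB : DifferentiableAt ℝ B x)
    (hg : g =ᶠ[𝓝 x] fun y => A y * B y) (hB0 : B x = 0) (hA0 : A x ≠ 0) :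
    Function.Surjective (fderiv ℝ g x) ↔ Function.Surjective (fderiv ℝ B x) := by
  rw [hg.fderiv_eq, fderiv_fun_mul hA hB, hB0]
  have h : ∀ v, (A x • fderiv ℝ B x + (0 : ℂ) • fderiv ℝ A x) v = A x * fderiv ℝ B x v :=
    fun v => by simp
  constructor
  · intro hs y
    obtain ⟨v, hv⟩ := hs (A x * y)
    exact ⟨v, mul_left_cancel₀ hA0 ((h v).symm.trans hv)⟩
  · intro hs y
    obtain ⟨v, hv⟩ := hs ((A x)⁻¹ * y)
    exact ⟨v, by rw [h, hv, mul_inv_cancel_left₀ hA0]⟩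

/-! ### The pull-back of a mixed polynomial to a toric chart -/

/-- The pairing of a weight with an exponent. -/
def natPairing {n : ℕ} (P a : Fin n → ℕ) : ℕ := ∑ i, P i * a i

theorem weightPairing_radialExponent {n : ℕ} (P : Fin n → ℕ) (m : (Fin n → ℕ) × (Fin n → ℕ)) :
    weightPairing (toReal P) (radialExponent m) = natPairing P m.1 + natPairing P m.2 := by
  simp [weightPairing, toReal, radialExponent, natPairing, mul_add, Finset.sum_add_distrib]

theorem weightPairing_polarExponent {n : ℕ} (P : Fin n → ℕ) (m : (Fin n → ℕ) × (Fin n → ℕ)) :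
    weightPairing (toReal P) (polarExponent m) = natPairing P m.1 - natPairing P m.2 := by
  simp [weightPairing, toReal, polarExponent, natPairing, mul_sub, Finset.sum_sub_distrib]

theorem prod_chartProj_pow {n : ℕ} {S : RegularSubdivision n} {σ : S.MaxCone} (u : ChartSpace σ)
    (a : Fin n → ℕ) : ∏ i, chartProj σ u i ^ a i = ∏ P, u P ^ natPairing P.1 a := by
  simp only [chartProj, ← Finset.prod_pow, ← pow_mul]
  rw [Finset.prod_comm]
  exact Finset.prod_congr rfl fun P _ => Finset.prod_pow_eq_pow_sum _ _ _

theorem monomial_chartProj {n : ℕ} {S : RegularSubdivision n} {σ : S.MaxCone} (u : ChartSpace σ)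
    (m : (Fin n → ℕ) × (Fin n → ℕ)) :
    (∏ i, chartProj σ u i ^ m.1 i) * ∏ i, conj (chartProj σ u i) ^ m.2 i =
      ∏ P, mixedPow (natPairing P.1 m.1) (natPairing P.1 m.2) (u P) := by
  simp only [mixedPow, zpow_natCast]
  rw [Finset.prod_mul_distrib, prod_chartProj_pow]
  have := congrArg conj (prod_chartProj_pow u m.2)
  simp only [map_prod, map_pow] at this
  rw [this]

open Classical in
/-- The exponent of the coordinates `u_P` in the pull-back of `z ^ a`, divided by that of `z ^ a₀`
for `P ∈ τ`. -/
noncomputable def chartExponent {n : ℕ} {S : RegularSubdivision n} (σ : S.MaxCone)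
    (τ : Finset (Fin n → ℕ)) (a₀ a : Fin n → ℕ) (P : {P : Fin n → ℕ // P ∈ σ.1}) : ℤ :=
  natPairing P.1 a - if P.1 ∈ τ then (natPairing P.1 a₀ : ℤ) else 0

open Classical in
/-- The part of the pull-back of the monomial `m₀` which involves the coordinates `u_P`, `P ∈ τ`. -/
noncomputable def chartFactor {n : ℕ} {S : RegularSubdivision n} (σ : S.MaxCone)
    (τ : Finset (Fin n → ℕ)) (m₀ : (Fin n → ℕ) × (Fin n → ℕ)) (u : ChartSpace σ) : ℂ :=
  ∏ P, mixedPow (if P.1 ∈ τ then (natPairing P.1 m₀.1 : ℤ) else 0)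
    (if P.1 ∈ τ then (natPairing P.1 m₀.2 : ℤ) else 0) (u P)

open Classical in
/-- The coordinates of a chart belonging to `τ`. -/
noncomputable def coordsIn {n : ℕ} {S : RegularSubdivision n} (σ : S.MaxCone)
    (τ : Finset (Fin n → ℕ)) : Finset {P : Fin n → ℕ // P ∈ σ.1} :=
  Finset.univ.filter fun P => P.1 ∈ τ

theorem mem_coordsIn {n : ℕ} {S : RegularSubdivision n} {σ : S.MaxCone}
    {τ : Finset (Fin n → ℕ)} {P : {P : Fin n → ℕ // P ∈ σ.1}} :
    P ∈ coordsIn σ τ ↔ P.1 ∈ τ := by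
  classical
  simp [coordsIn]

theorem card_coordsIn {n : ℕ} {S : RegularSubdivision n} {σ : S.MaxCone}
    {τ : Finset (Fin n → ℕ)} (h : τ ⊆ σ.1) : (coordsIn σ τ).card = τ.card := by
  refine Finset.card_bij (fun P _ => P.1) (fun P hP => mem_coordsIn.1 hP)
    (fun P _ Q _ h => Subtype.ext h) fun P hP => ⟨⟨P, h hP⟩, mem_coordsIn.2 hP, rfl⟩

theorem sum_monomial_chartProj {n : ℕ} {S : RegularSubdivision n} {σ : S.MaxCone}
    {τ : Finset (Fin n → ℕ)} (s : Finset ((Fin n → ℕ) × (Fin n → ℕ)))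
    (c : (Fin n → ℕ) × (Fin n → ℕ) → ℂ) (m₀ : (Fin n → ℕ) × (Fin n → ℕ)) {u : ChartSpace σ}
    (hu : ∀ P ∈ coordsIn σ τ, u P ≠ 0) :
    ∑ m ∈ s, c m * ((∏ i, chartProj σ u i ^ m.1 i) * ∏ i, conj (chartProj σ u i) ^ m.2 i) =
      chartFactor σ τ m₀ u * mixedLaurent s c (fun m => chartExponent σ τ m₀.1 m.1)
        (fun m => chartExponent σ τ m₀.2 m.2) u := by
  rw [mixedLaurent, Finset.mul_sum]
  refine Finset.sum_congr rfl fun m _ => ?_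
  rw [monomial_chartProj, mul_left_comm, chartFactor, ← Finset.prod_mul_distrib]
  refine congrArg _ (Finset.prod_congr rfl fun P _ => ?_)
  by_cases hP : P.1 ∈ τ
  · simp only [chartExponent, hP, if_true]
    rw [← mixedPow_add (hu P (mem_coordsIn.2 hP))]
    congr 1 <;> ring
  · simp [chartExponent, hP, mixedPow_zero_exponents]

theorem chartFactor_ne_zero {n : ℕ} {S : RegularSubdivision n} {σ : S.MaxCone}
    {τ : Finset (Fin n → ℕ)} (m₀ : (Fin n → ℕ) × (Fin n → ℕ)) {u : ChartSpace σ}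
    (hu : ∀ P ∈ coordsIn σ τ, u P ≠ 0) : chartFactor σ τ m₀ u ≠ 0 := by
  refine Finset.prod_ne_zero_iff.2 fun P _ => ?_
  by_cases hP : P.1 ∈ τ
  · exact mixedPow_ne_zero (hu P (mem_coordsIn.2 hP))
  · simp [hP, mixedPow_zero_exponents]

theorem differentiableAt_chartFactor {n : ℕ} {S : RegularSubdivision n} {σ : S.MaxCone}
    {τ : Finset (Fin n → ℕ)} (m₀ : (Fin n → ℕ) × (Fin n → ℕ)) {u : ChartSpace σ}
    (hu : ∀ P, u P ≠ 0) : DifferentiableAt ℝ (chartFactor σ τ m₀) u := by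
  refine ContDiffAt.differentiableAt (n := 1) (contDiffAt_prod fun P _ => ?_) one_ne_zero
  exact ContDiffAt.comp u (contDiffAt_mixedPow _ _ (hu P)) (ContinuousLinearMap.proj (R := ℝ)
    (φ := fun _ : {P : Fin n → ℕ // P ∈ σ.1} => ℂ) P).contDiff.contDiffAt

theorem eventually_apply_ne_zero {ι : Type*} [Finite ι] {u₀ : ι → ℂ} {p : ι → Prop}
    (h : ∀ j, p j → u₀ j ≠ 0) : ∀ᶠ u in 𝓝 u₀, ∀ j, p j → u j ≠ 0 := by
  refine Filter.eventually_all.2 fun j => ?_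
  by_cases hj : p j
  · filter_upwards [(continuous_apply j).continuousAt.eventually_ne (h j hj)] with u hu _ using hu
  · exact Filter.Eventually.of_forall fun _ h => absurd h hj

/-- The assumptions on `f` and on the subdivision that enter the local analysis. -/
structure IsAdmissiblePair {n : ℕ} (f : MixedPoly n) (S : RegularSubdivision n) : Prop where
  dim_ne_zero : n ≠ 0
  convenient : IsConvenient f
  nondegenerate : IsNewtonNondegenerate f
  faceType : IsStronglyPolarNonnegFaceType f
  admissible : S.IsAdmissible f

/-- The function `F` with `f ∘ π_σ = (∏_{P ∈ τ} u_P ^ a_P * ū_P ^ b_P) F`, where the factor is the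
one belonging to the monomial `m₀`. -/
noncomputable def chartQuotient {n : ℕ} {S : RegularSubdivision n} (f : MixedPoly n)
    (σ : S.MaxCone) (τ : Finset (Fin n → ℕ)) (m₀ : (Fin n → ℕ) × (Fin n → ℕ)) :
    ChartSpace σ → ℂ :=
  mixedLaurent f.support f (fun m => chartExponent σ τ m₀.1 m.1)
    fun m => chartExponent σ τ m₀.2 m.2

theorem eval_chartProj {n : ℕ} {S : RegularSubdivision n} (f : MixedPoly n) {σ : S.MaxCone}
    {τ : Finset (Fin n → ℕ)} (m₀ : (Fin n → ℕ) × (Fin n → ℕ)) {u : ChartSpace σ}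
    (hu : ∀ P ∈ coordsIn σ τ, u P ≠ 0) :
    f.eval (chartProj σ u) = chartFactor σ τ m₀ u * chartQuotient f σ τ m₀ u :=
  (eval_eq_sum f _).trans (sum_monomial_chartProj f.support f m₀ hu)

/-! ### Exponents in a toric chart -/

section Exponents

variable {n : ℕ} {f : MixedPoly n} {S : RegularSubdivision n} {σ : S.MaxCone}
  {τ : Finset (Fin n → ℕ)} {m₀ m : (Fin n → ℕ) × (Fin n → ℕ)}
  {P : {P : Fin n → ℕ // P ∈ σ.1}}

theorem chartExponent_add (hP : P.1 ∈ τ) (hm₀ : radialExponent m₀ ∈ face f (toReal P.1)) :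
    ((chartExponent σ τ m₀.1 m.1 P + chartExponent σ τ m₀.2 m.2 P : ℤ) : ℝ) =
      weightPairing (toReal P.1) (radialExponent m) - minValue f (toReal P.1) := by
  rw [← hm₀.2, weightPairing_radialExponent, weightPairing_radialExponent]
  simp only [chartExponent, hP, if_true]
  push_cast
  ring

/-- The monomials on the face `Δ(P)` have the same exponents of `u_P` and `ū_P` as `m₀`: their sums
agree by radial and their differences by polar homogeneity. -/
theorem chartExponent_eq_zero_iff (h : IsAdmissiblePair f S) (hP : P.1 ∈ τ)
    (hm₀s : m₀ ∈ f.support) (hm₀ : radialExponent m₀ ∈ face f (toReal P.1)) (hm : m ∈ f.support) :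
    (chartExponent σ τ m₀.1 m.1 P = 0 ∧ chartExponent σ τ m₀.2 m.2 P = 0) ↔
      radialExponent m ∈ face f (toReal P.1) := by
  have hsum := chartExponent_add (σ := σ) (m := m) hP hm₀
  rw [radialExponent_mem_face hm]
  constructor
  · rintro ⟨h1, h2⟩
    rw [h1, h2] at hsum
    simp only [add_zero, Int.cast_zero] at hsum
    linarith
  · intro hmin
    rw [hmin, sub_self] at hsum
    obtain ⟨d, hd⟩ := polar_homogeneous_of_nonneg h.dim_ne_zero h.convenient h.faceType
      (toReal P.1) fun i => Nat.cast_nonneg _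
    have h1 := hd m hm hmin
    rw [← hd m₀ hm₀s hm₀.2, weightPairing_polarExponent, weightPairing_polarExponent] at h1
    have hdiff : ((chartExponent σ τ m₀.1 m.1 P - chartExponent σ τ m₀.2 m.2 P : ℤ) : ℝ) = 0 := by
      simp only [chartExponent, hP, if_true]
      push_cast
      linarith
    norm_cast at hsum hdiff
    omega

theorem one_le_chartExponent_add (hP : P.1 ∈ τ)
    (hm₀ : radialExponent m₀ ∈ face f (toReal P.1)) (hm : m ∈ f.support)
    (hmP : radialExponent m ∉ face f (toReal P.1)) :
    1 ≤ chartExponent σ τ m₀.1 m.1 P + chartExponent σ τ m₀.2 m.2 P := by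
  have hsum := chartExponent_add (σ := σ) (m := m) hP hm₀
  have hlt : minValue f (toReal P.1) < weightPairing (toReal P.1) (radialExponent m) :=
    lt_of_le_of_ne (minValue_le (fun i => Nat.cast_nonneg _) hm)
      fun h => hmP ((radialExponent_mem_face hm).2 h.symm)
  have : (0 : ℝ) < (chartExponent σ τ m₀.1 m.1 P + chartExponent σ τ m₀.2 m.2 P : ℤ) := by
    rw [hsum]; linarith
  have : 0 < chartExponent σ τ m₀.1 m.1 P + chartExponent σ τ m₀.2 m.2 P := by exact_mod_cast this
  omega

end Exponents

/-! ### The strict transform near a stratum -/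

section Local

variable {n : ℕ} {f : MixedPoly n} {S : RegularSubdivision n} {σ : S.MaxCone}
  {τ : Finset (Fin n → ℕ)} {m₀ : (Fin n → ℕ) × (Fin n → ℕ)} {u₀ : ChartSpace σ}

/-- Newton non-degeneracy along the face `⋂_{P ∈ τ} Δ(P)` makes the initial part of the quotient a
submersion at its zeros with `u_τ = 0`. -/
theorem isTransversal_chartQuotient (h : IsAdmissiblePair f S) (hτσ : τ ⊆ σ.1)
    (hτ : τ.Nonempty) (hpos : ∀ P ∈ τ, StrictlyPositive P) (hm₀s : m₀ ∈ f.support)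
    (hm₀ : ∀ P ∈ τ, radialExponent m₀ ∈ face f (toReal P))
    (hu₀ : zeroVertices u₀ = (τ : Set (Fin n → ℕ))) (h0 : chartQuotient f σ τ m₀ u₀ = 0) :
    IsTransversal f.support f (fun m => chartExponent σ τ m₀.1 m.1)
      (fun m => chartExponent σ τ m₀.2 m.2) (coordsIn σ τ) u₀ := by
  classical
  have hz : ∀ P ∈ coordsIn σ τ, u₀ P = 0 := fun P hP => by
    obtain ⟨_, h⟩ : P.1 ∈ zeroVertices u₀ := hu₀ ▸ mem_coordsIn.1 hP
    exact h
  have hnz : ∀ P, P ∉ coordsIn σ τ → u₀ P ≠ 0 := fun P hP h0 =>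
    hP (mem_coordsIn.2 (hu₀.subset ⟨P.2, h0⟩))
  have hdeg : ∀ m ∈ f.support, ∀ P ∈ coordsIn σ τ,
      (chartExponent σ τ m₀.1 m.1 P = 0 ∧ chartExponent σ τ m₀.2 m.2 P = 0) ∨
        1 ≤ chartExponent σ τ m₀.1 m.1 P + chartExponent σ τ m₀.2 m.2 P := by
    intro m hm P hP
    have hPτ := mem_coordsIn.1 hP
    by_cases hmP : radialExponent m ∈ face f (toReal P.1)
    · exact Or.inl ((chartExponent_eq_zero_iff h hPτ hm₀s (hm₀ _ hPτ) hm).2 hmP)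
    · exact Or.inr (one_le_chartExponent_add hPτ (hm₀ _ hPτ) hm hmP)
  refine ⟨hz, hnz, hdeg, ?_⟩
  set W : Fin n → ℝ := ∑ P ∈ τ, toReal P with hW
  have hWpos : ∀ i, 0 < W i := fun i => by
    rw [hW, Finset.sum_apply]
    exact Finset.sum_pos (fun P hP => by simpa [toReal] using hpos P hP i) hτ
  have hτS : τ ∈ S.cones := S.face_mem _ σ.2.1 _ hτσ
  set F₀ : ChartSpace σ → ℂ := mixedLaurent (initialTerms f.support
    (fun m => chartExponent σ τ m₀.1 m.1) (fun m => chartExponent σ τ m₀.2 m.2) (coordsIn σ τ)) f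
      (fun m => chartExponent σ τ m₀.1 m.1) (fun m => chartExponent σ τ m₀.2 m.2) with hF₀
  have hterms : initialTerms f.support (fun m => chartExponent σ τ m₀.1 m.1)
      (fun m => chartExponent σ τ m₀.2 m.2) (coordsIn σ τ) =
      f.support.filter fun m => radialExponent m ∈ face f W := by
    ext m
    rw [mem_initialTerms, Finset.mem_filter]
    refine and_congr_right fun hm => ?_
    rw [mem_face_sum_iff ⟨m₀, hm₀s⟩ h.admissible hτS hm]
    constructor
    · intro H P hP
      exact (chartExponent_eq_zero_iff (P := ⟨P, hτσ hP⟩) h hP hm₀s (hm₀ P hP) hm).1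
        (H ⟨P, hτσ hP⟩ (mem_coordsIn.2 hP))
    · intro H P hP
      have hPτ := mem_coordsIn.1 hP
      exact (chartExponent_eq_zero_iff h hPτ hm₀s (hm₀ _ hPτ) hm).2 (H _ hPτ)
  have hface : ∀ u : ChartSpace σ, (∀ P ∈ coordsIn σ τ, u P ≠ 0) →
      (faceFunction f (face f W)).eval (chartProj σ u) = chartFactor σ τ m₀ u * F₀ u := by
    intro u hu
    rw [eval_faceFunction, hF₀, hterms]
    exact sum_monomial_chartProj _ f m₀ hu
  -- the point of the torus obtained by changing the vanishing coordinates to `1`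
  let v : ChartSpace σ := fun P => if P ∈ coordsIn σ τ then 1 else u₀ P
  have hv : ∀ P, v P ≠ 0 := fun P => by
    by_cases hP : P ∈ coordsIn σ τ
    · simp [v, hP]
    · simpa [v, hP] using hnz P hP
  have hvu : ∀ P, P ∉ coordsIn σ τ → v P = u₀ P := fun P hP => by simp [v, hP]
  have hF₀v : F₀ v = 0 := by
    rw [hF₀, initial_congr hvu, ← mixedLaurent_eq_initial hdeg hz]
    exact h0
  rw [← fderiv_initial_congr hvu]
  have hev : (fun u => (faceFunction f (face f W)).eval (chartProj σ u)) =ᶠ[𝓝 v]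
      fun u => chartFactor σ τ m₀ u * F₀ u := by
    filter_upwards [eventually_apply_ne_zero (p := fun _ => True) fun P _ => hv P] with u hu
    exact hface u fun P _ => hu P trivial
  refine (surjective_fderiv_mul_iff (differentiableAt_chartFactor m₀ hv)
    ((contDiffAt_initial (r := 1) fun P _ => hv P).differentiableAt one_ne_zero) hev hF₀v
    (chartFactor_ne_zero m₀ fun P _ => hv P)).1 ?_
  refine (surjective_fderiv_comp_chartProj_iff hv _).2 ?_
  refine h.nondegenerate _ (isCompactFace_face h.dim_ne_zero f hWpos) _
    (chartProj_apply_ne_zero hv) ?_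
  rw [hface v fun P _ => hv P, hF₀v, mul_zero]

/-- Near the stratum `u_τ = 0` the strict transform is contained in the zeros of the quotient. -/
theorem chartQuotient_eq_zero_of_mem (h : IsAdmissiblePair f S)
    (hpos : ∀ P ∈ τ, StrictlyPositive P) (hm₀s : m₀ ∈ f.support)
    (hm₀ : ∀ P ∈ τ, radialExponent m₀ ∈ face f (toReal P)) {u : ChartSpace σ}
    (hu : ∀ P, P ∉ coordsIn σ τ → u P ≠ 0) (hmem : u ∈ chartStrictTransform f σ) :
    chartQuotient f σ τ m₀ u = 0 := by
  have hcont : ContinuousAt (chartQuotient f σ τ m₀) u := by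
    refine (contDiffAt_mixedLaurent (r := 0) fun m hm P => ?_).continuousAt
    by_cases hP : P ∈ coordsIn σ τ
    · have hPτ := mem_coordsIn.1 hP
      by_cases hmP : radialExponent m ∈ face f (toReal P.1)
      · exact Or.inr (contDiff_mixedPow_of_eq_zero
          ((chartExponent_eq_zero_iff h hPτ hm₀s (hm₀ _ hPτ) hm).2 hmP))
      · exact Or.inr (contDiff_mixedPow 0
          (by simpa using one_le_chartExponent_add hPτ (hm₀ _ hPτ) hm hmP))
    · exact Or.inl (hu P hP)
  by_contra hne
  obtain ⟨v, ⟨hv0, hvne⟩, hv⟩ :=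
    ((mem_closure_iff_frequently.1 hmem).and_eventually (hcont.eventually_ne hne)).exists
  have hvτ : ∀ P ∈ coordsIn σ τ, v P ≠ 0 := fun P hP h0 =>
    hvne (chartProj_eq_zero (hpos _ (mem_coordsIn.1 hP)) h0)
  rw [eval_chartProj f m₀ hvτ] at hv0
  exact hv ((mul_eq_zero.1 hv0).resolve_left (chartFactor_ne_zero m₀ hvτ))

/-- Near a zero `u₀` of the quotient with `u_τ = 0` the strict transform is its zero set. -/
theorem eventually_mem_chartStrictTransform_iff (h : IsAdmissiblePair f S) (hτσ : τ ⊆ σ.1)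
    (hτ : τ.Nonempty) (hpos : ∀ P ∈ τ, StrictlyPositive P) (hm₀s : m₀ ∈ f.support)
    (hm₀ : ∀ P ∈ τ, radialExponent m₀ ∈ face f (toReal P))
    (hu₀ : zeroVertices u₀ = (τ : Set (Fin n → ℕ))) (h0 : chartQuotient f σ τ m₀ u₀ = 0) :
    ∀ᶠ u in 𝓝 u₀, u ∈ chartStrictTransform f σ ↔ chartQuotient f σ τ m₀ u = 0 := by
  have htr := isTransversal_chartQuotient h hτσ hτ hpos hm₀s hm₀ hu₀ h0
  have hne := eventually_apply_ne_zero htr.ne_zero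
  filter_upwards [htr.eventually_mem_closure, hne.eventually_nhds] with u hcl hu
  refine ⟨chartQuotient_eq_zero_of_mem h hpos hm₀s hm₀ hu.self_of_nhds, fun hF => ?_⟩
  refine mem_closure_iff_frequently.2
    (((mem_closure_iff_frequently.1 (hcl hF)).and_eventually hu).mono ?_)
  rintro v ⟨⟨hv0, hvτ⟩, hv⟩
  refine ⟨?_, chartProj_ne_zero h.dim_ne_zero fun P => ?_⟩
  · rw [eval_chartProj f m₀ hvτ]
    exact mul_eq_zero_of_right _ hv0
  · by_cases hP : P ∈ coordsIn σ τ
    · exact hvτ P hP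
    · exact hv P hP

/-- Near a zero `u₀` of the quotient with `u_τ = 0` the function `f` is a submersion at the images
of the points of the torus where it vanishes. -/
theorem eventually_surjective_fderiv_eval (h : IsAdmissiblePair f S) (hτσ : τ ⊆ σ.1)
    (hτ : τ.Nonempty) (hpos : ∀ P ∈ τ, StrictlyPositive P) (hm₀s : m₀ ∈ f.support)
    (hm₀ : ∀ P ∈ τ, radialExponent m₀ ∈ face f (toReal P))
    (hu₀ : zeroVertices u₀ = (τ : Set (Fin n → ℕ))) (h0 : chartQuotient f σ τ m₀ u₀ = 0) :
    ∀ᶠ u in 𝓝 u₀, (∀ P, u P ≠ 0) → f.eval (chartProj σ u) = 0 →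
      Function.Surjective (fderiv ℝ f.eval (chartProj σ u)) := by
  have htr := isTransversal_chartQuotient h hτσ hτ hpos hm₀s hm₀ hu₀ h0
  filter_upwards [htr.eventually_surjective_cubeOn] with u hsurj hu hfu
  -- `f ∘ π_σ ∘ k` is a product of a non-vanishing function and `F ∘ k`, which is a submersion
  set k := cubeOn (coordsIn σ τ) with hk
  set w := k.symm u with hw
  have hkw : k w = u := k.apply_symm_apply u
  have hwne : ∀ P, w P ≠ 0 := fun P h => hu P (by rw [← hkw, hk, cubeOn_apply_eq_zero, h])
  have hdk : DifferentiableAt ℝ k w := differentiable_cubeOn _ w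
  have hF0 : chartQuotient f σ τ m₀ (k w) = 0 := by
    rw [hkw]
    rw [eval_chartProj f m₀ fun P _ => hu P] at hfu
    exact (mul_eq_zero.1 hfu).resolve_left (chartFactor_ne_zero m₀ fun P _ => hu P)
  have hev : (fun v => f.eval (chartProj σ (k v))) =ᶠ[𝓝 w]
      fun v => chartFactor σ τ m₀ (k v) * chartQuotient f σ τ m₀ (k v) := by
    filter_upwards [eventually_apply_ne_zero (p := fun _ => True) fun P _ => hwne P] with v hv
    exact eval_chartProj f m₀ fun P _ h => hv P trivial (cubeOn_apply_eq_zero.1 h)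
  have hfac : DifferentiableAt ℝ (fun v => chartFactor σ τ m₀ (k v)) w := by
    refine DifferentiableAt.comp (g := chartFactor σ τ m₀) w ?_ hdk
    rw [hkw]
    exact differentiableAt_chartFactor m₀ hu
  have hs := (surjective_fderiv_mul_iff hfac
    ((contDiffAt_mixedLaurent_cubeOn htr.deg fun P _ => hwne P).differentiableAt one_ne_zero) hev
    hF0 (by rw [hkw]; exact chartFactor_ne_zero m₀ fun P _ => hu P)).2 hsurj
  have hcomp : fderiv ℝ (fun v => f.eval (chartProj σ (k v))) w =
      (fderiv ℝ f.eval (chartProj σ (k w))).comp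
        ((fderiv ℝ (chartProj σ) (k w)).comp (fderiv ℝ k w)) :=
    ((differentiable_eval f _).hasFDerivAt.comp w
      ((differentiable_chartProj σ _).hasFDerivAt.comp w hdk.hasFDerivAt)).fderiv
  rw [hcomp, ContinuousLinearMap.coe_comp, hkw] at hs
  exact hs.of_comp

end Local

/-! ### The number `Λ` -/

theorem exists_isLeast_natCast {A : Set ℝ} (hA : A.Nonempty)
    (h : ∀ x ∈ A, ∃ k : ℕ, 1 ≤ k ∧ x = k) : ∃ k : ℕ, 1 ≤ k ∧ IsLeast A (k : ℝ) := by
  classical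
  have hex : ∃ k : ℕ, (k : ℝ) ∈ A := by
    obtain ⟨x, hx⟩ := hA
    obtain ⟨k, -, rfl⟩ := h x hx
    exact ⟨k, hx⟩
  refine ⟨Nat.find hex, ?_, Nat.find_spec hex, ?_⟩
  · obtain ⟨k, hk, hfk⟩ := h _ (Nat.find_spec hex)
    rw [Nat.cast_inj] at hfk
    omega
  · intro x hx
    obtain ⟨k, -, rfl⟩ := h x hx
    exact_mod_cast Nat.find_min' hex hx

theorem exists_natCast_of_mem_excessSet {n : ℕ} {f : MixedPoly n} {τ : Finset (Fin n → ℕ)} {x : ℝ}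
    (hx : x ∈ excessSet f τ) : ∃ k : ℕ, 1 ≤ k ∧ x = k := by
  obtain ⟨P, -, m, hm, hmP, rfl⟩ := hx
  have h0 : ∀ i, 0 ≤ toReal P i := fun i => Nat.cast_nonneg _
  obtain ⟨m₀, hm₀, hmin⟩ := exists_minValue_eq ⟨m, hm⟩ h0
  have hlt : minValue f (toReal P) < weightPairing (toReal P) (radialExponent m) :=
    lt_of_le_of_ne (minValue_le h0 hm) fun h => hmP ((radialExponent_mem_face hm).2 h.symm)
  rw [hmin, weightPairing_radialExponent, weightPairing_radialExponent] at hlt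
  have hlt' : natPairing P m₀.1 + natPairing P m₀.2 < natPairing P m.1 + natPairing P m.2 := by
    exact_mod_cast hlt
  refine ⟨natPairing P m.1 + natPairing P m.2 - (natPairing P m₀.1 + natPairing P m₀.2),
    by omega, ?_⟩
  rw [hmin, weightPairing_radialExponent, weightPairing_radialExponent, Nat.cast_sub hlt'.le]
  push_cast
  rfl

theorem isLeast_lambdaOfCone {n : ℕ} {f : MixedPoly n} {τ : Finset (Fin n → ℕ)}
    (h : (excessSet f τ).Nonempty) : IsLeast (excessSet f τ) (lambdaOfCone f τ) := by
  obtain ⟨k, -, hk⟩ := exists_isLeast_natCast h fun x hx => exists_natCast_of_mem_excessSet hx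
  rwa [lambdaOfCone, hk.csInf_eq]

theorem exists_isLeast_lambdaSet {n : ℕ} {f : MixedPoly n} {S : RegularSubdivision n}
    (h : (lambdaSet S f).Nonempty) : ∃ k : ℕ, 1 ≤ k ∧ IsLeast (lambdaSet S f) (k : ℝ) := by
  refine exists_isLeast_natCast h ?_
  rintro _ ⟨τ, -, -, hne, -, rfl⟩
  exact exists_natCast_of_mem_excessSet (isLeast_lambdaOfCone hne).1

/-! ### The strata and the neighbourhood of the exceptional fibre -/

theorem exists_finset_eq_zeroVertices {n : ℕ} {S : RegularSubdivision n} {σ : S.MaxCone}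
    (u : ChartSpace σ) : ∃ τ ⊆ σ.1, zeroVertices u = (τ : Set (Fin n → ℕ)) := by
  classical
  refine ⟨σ.1.filter (· ∈ zeroVertices u), Finset.filter_subset _ _, ?_⟩
  ext P
  simp only [Finset.coe_filter, Set.mem_ofPred_eq]
  exact ⟨fun h => ⟨h.1, h⟩, fun h => h.2⟩

theorem subset_of_zeroVertices_eq {n : ℕ} {S : RegularSubdivision n} {σ : S.MaxCone}
    {u : ChartSpace σ} {τ : Finset (Fin n → ℕ)} (h : zeroVertices u = (τ : Set (Fin n → ℕ))) :
    τ ⊆ σ.1 := fun P hP => by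
  obtain ⟨h1, -⟩ : P ∈ zeroVertices u := h ▸ hP
  exact h1

theorem apply_ne_zero_of_notMem_coordsIn {n : ℕ} {S : RegularSubdivision n} {σ : S.MaxCone}
    {u : ChartSpace σ} {τ : Finset (Fin n → ℕ)} (h : zeroVertices u = (τ : Set (Fin n → ℕ)))
    (P : {P : Fin n → ℕ // P ∈ σ.1}) (hP : P ∉ coordsIn σ τ) : u P ≠ 0 := fun h0 =>
  hP (mem_coordsIn.2 (h.subset ⟨P.2, h0⟩))

theorem card_maxCone {n : ℕ} {S : RegularSubdivision n} (σ : S.MaxCone) :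
    Fintype.card {P : Fin n → ℕ // P ∈ σ.1} = n := by
  simpa using σ.2.2

/-- Each non-empty stratum of the strict transform is an analytic submanifold near each of its
points. -/
theorem isSubmanifoldAt_strictTransformStratum {n : ℕ} {f : MixedPoly n}
    {S : RegularSubdivision n} (h : IsAdmissiblePair f S) {τ : Finset (Fin n → ℕ)}
    (hτS : τ ∈ S.cones) (hτ : τ.Nonempty) (hpos : ∀ P ∈ τ, StrictlyPositive P) {σ : S.MaxCone}
    {u₀ : ChartSpace σ} (hu₀ : chartIncl σ u₀ ∈ strictTransformStratum S f τ) :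
    τ.card + 1 ≤ n ∧ IsSubmanifoldAt ω (2 * (n - τ.card - 1))
      (chartIncl σ ⁻¹' strictTransformStratum S f τ) u₀ := by
  obtain ⟨hV, hE⟩ := hu₀
  rw [chartIncl_mem_strictTransform] at hV
  rw [chartIncl_mem_divisorStratum] at hE
  have hτσ := subset_of_zeroVertices_eq hE
  obtain ⟨m₀, hm₀s, hm₀⟩ := exists_common_monomial
    (support_nonempty_of_isConvenient h.dim_ne_zero h.convenient) h.admissible hτS
  have hne := apply_ne_zero_of_notMem_coordsIn hE
  have h0 := chartQuotient_eq_zero_of_mem h hpos hm₀s hm₀ hne hV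
  have htr := isTransversal_chartQuotient h hτσ hτ hpos hm₀s hm₀ hE h0
  have := htr.isSubmanifoldAt_stratum (V := chartIncl σ ⁻¹' strictTransformStratum S f τ) (by
    filter_upwards [eventually_mem_chartStrictTransform_iff h hτσ hτ hpos hm₀s hm₀ hE h0,
      eventually_apply_ne_zero hne] with u hu hune
    rw [strictTransformStratum, Set.mem_preimage, Set.mem_inter_iff, chartIncl_mem_strictTransform,
      chartIncl_mem_divisorStratum, hu, and_comm]
    refine and_congr_left fun _ => ⟨fun hZ P hP => ?_, fun hz => Set.Subset.antisymm ?_ ?_⟩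
    · obtain ⟨_, h⟩ : P.1 ∈ zeroVertices u := hZ ▸ mem_coordsIn.1 hP
      exact h
    · rintro P ⟨hP, h⟩
      by_contra hPτ
      exact hune ⟨P, hP⟩ (fun h => hPτ (mem_coordsIn.1 h)) h
    · exact fun P hP => ⟨hτσ hP, hz ⟨P, hτσ hP⟩ (mem_coordsIn.2 hP)⟩)
  rwa [card_maxCone, card_coordsIn hτσ] at this

/-- The points on a divisor of a vertex that is not strictly positive, and the points outside all
divisors which lie over singular points of `f = 0`. -/
def singularPoints {n : ℕ} (S : RegularSubdivision n) (f : MixedPoly n) :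
    Set (ToricModification S) :=
  {x | ∃ P, x ∈ divisor S P ∧ ¬StrictlyPositive P} ∪
    {x | (∀ P, x ∉ divisor S P) ∧ f.eval (toricProj S x) = 0 ∧
      ¬Function.Surjective (fderiv ℝ f.eval (toricProj S x))}

/-- The complement of the closure of the singular points. -/
def regularNeighborhood {n : ℕ} (S : RegularSubdivision n) (f : MixedPoly n) :
    Set (ToricModification S) :=
  (closure (singularPoints S f))ᶜ

theorem isOpen_regularNeighborhood {n : ℕ} (S : RegularSubdivision n) (f : MixedPoly n) :
    IsOpen (regularNeighborhood S f) :=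
  isClosed_closure.isOpen_compl

/-- Under Assumption (*) singular points do not accumulate at the exceptional fibre of the strict
transform. -/
theorem strictTransform_inter_exceptionalSet_subset {n : ℕ} {f : MixedPoly n}
    {S : RegularSubdivision n} (h : IsAdmissiblePair f S) (hstar : AssumptionStar S f) :
    strictTransform S f ∩ exceptionalSet S ⊆ regularNeighborhood S f := by
  rintro x hx hcl
  obtain ⟨σ, u₀, rfl, ⟨P₀, hP₀⟩, hpos'⟩ := hstar x hx
  obtain ⟨τ, hτσ, hE⟩ := exists_finset_eq_zeroVertices u₀
  have hpos : ∀ P ∈ τ, StrictlyPositive P := fun P hP => by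
    obtain ⟨h1, h2⟩ : P ∈ zeroVertices u₀ := hE ▸ hP
    exact hpos' ⟨P, h1⟩ h2
  have hτ : τ.Nonempty := ⟨P₀.1, hE.subset ⟨P₀.2, hP₀⟩⟩
  obtain ⟨m₀, hm₀s, hm₀⟩ := exists_common_monomial
    (support_nonempty_of_isConvenient h.dim_ne_zero h.convenient) h.admissible
    (S.face_mem _ σ.2.1 _ hτσ)
  have hne := apply_ne_zero_of_notMem_coordsIn hE
  have h0 := chartQuotient_eq_zero_of_mem h hpos hm₀s hm₀ hne
    (chartIncl_mem_strictTransform.1 hx.1)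
  have hcl' : u₀ ∈ closure (chartIncl σ ⁻¹' singularPoints S f) := by
    rw [← (isOpenMap_chartIncl σ).preimage_closure_eq_closure_preimage (continuous_chartIncl σ)]
    exact hcl
  obtain ⟨u, hu, hsurj, hune⟩ := ((mem_closure_iff_frequently.1 hcl').and_eventually
    ((eventually_surjective_fderiv_eval h hτσ hτ hpos hm₀s hm₀ hE h0).and
      (eventually_apply_ne_zero hne))).exists
  rcases hu with ⟨P, hP, hPpos⟩ | ⟨hdiv, hfu, hns⟩
  · obtain ⟨hPσ, hP0⟩ := chartIncl_mem_divisor.1 hP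
    refine hune ⟨P, hPσ⟩ (fun hPτ => hPpos (hpos P (mem_coordsIn.1 hPτ))) hP0
  · exact hns (hsurj (fun P hP => hdiv P.1 (chartIncl_mem_divisor.2 ⟨P.2, hP⟩)) hfu)

theorem mem_chartStrictTransform_iff_of_ne_zero {n : ℕ} (hn : n ≠ 0) {f : MixedPoly n}
    {S : RegularSubdivision n} {σ : S.MaxCone} {u : ChartSpace σ} (hu : ∀ P, u P ≠ 0) :
    u ∈ chartStrictTransform f σ ↔ f.eval (chartProj σ u) = 0 := by
  refine ⟨fun h => ?_, fun h => subset_closure ⟨h, chartProj_ne_zero hn hu⟩⟩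
  have hcl : IsClosed {u : ChartSpace σ | f.eval (chartProj σ u) = 0} :=
    isClosed_eq ((differentiable_eval f).continuous.comp (differentiable_chartProj σ).continuous)
      continuous_const
  exact closure_minimal (fun v hv => hv.1) hcl h

/-- At the points of the torus in the regular neighbourhood the strict transform is an analytic
submanifold. -/
theorem isSubmanifoldAt_of_ne_zero {n : ℕ} (hn : n ≠ 0) {f : MixedPoly n}
    {S : RegularSubdivision n} {σ : S.MaxCone} {u₀ : ChartSpace σ}
    (hV : chartIncl σ u₀ ∈ strictTransform S f) (hU : chartIncl σ u₀ ∈ regularNeighborhood S f)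
    (hu₀ : ∀ P, u₀ P ≠ 0) {M : Set (ChartSpace σ)}
    (hM : ∀ᶠ u in 𝓝 u₀, u ∈ M ↔ chartIncl σ u ∈ strictTransform S f) :
    IsSubmanifoldAt ω (2 * (n - 1)) M u₀ := by
  have hf0 : f.eval (chartProj σ u₀) = 0 :=
    (mem_chartStrictTransform_iff_of_ne_zero hn hu₀).1 (chartIncl_mem_strictTransform.1 hV)
  have hsurj : Function.Surjective (fderiv ℝ f.eval (chartProj σ u₀)) := by
    by_contra hns
    refine hU (subset_closure (Or.inr ⟨fun P hP => ?_, hf0, hns⟩))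
    obtain ⟨hPσ, hP0⟩ := chartIncl_mem_divisor.1 hP
    exact hu₀ _ hP0
  have h1 := isSubmanifoldAt_of_submersion (s := ω) (by simp) (by simp)
    (((contDiff_eval f).comp (contDiff_chartProj σ)).contDiffAt (x := u₀))
    ((surjective_fderiv_comp_chartProj_iff hu₀ f).2 hsurj) (M := M) (by
      filter_upwards [hM, eventually_apply_ne_zero (p := fun _ => True) fun P _ => hu₀ P]
        with u hu hune
      rw [hu, chartIncl_mem_strictTransform,
        mem_chartStrictTransform_iff_of_ne_zero hn fun P => hune P trivial]
      rfl)
  rw [finrank_real_pi, Complex.finrank_real_complex, card_maxCone] at h1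
  convert! h1 using 1
  omega

/-- In the regular neighbourhood the strict transform is a submanifold of class `C^r`, if every
`w ^ a * w̄ ^ b` whose degree `a + b` is one of the numbers `P(ν + μ) - d(P)` at a stratum met by
the strict transform is of class `C^r`. For `r = 0` nothing has to be assumed, because the radial
reparametrization takes care of the functions that are only continuous. -/
theorem isToricSubmanifold_of_regularity {n : ℕ} {f : MixedPoly n} {S : RegularSubdivision n}
    (h : IsAdmissiblePair f S) {r : WithTop ℕ∞} (hr : r ≠ ∞)
    (hreg : ∀ (τ : Finset (Fin n → ℕ)) (σ : S.MaxCone) (u : ChartSpace σ), τ ⊆ σ.1 →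
      (∀ P ∈ τ, StrictlyPositive P) → chartIncl σ u ∈ strictTransform S f →
      zeroVertices u = (τ : Set (Fin n → ℕ)) → r ≠ 0 → ∀ x ∈ excessSet f τ, ∀ a b : ℤ,
      ((a + b : ℤ) : ℝ) = x → ContDiff ℝ r (mixedPow a b)) :
    IsToricSubmanifold r (2 * (n - 1)) (strictTransform S f ∩ regularNeighborhood S f) := by
  rintro σ u₀ ⟨hV, hU⟩
  have hM : ∀ᶠ u in 𝓝 u₀, u ∈ chartIncl σ ⁻¹' (strictTransform S f ∩ regularNeighborhood S f) ↔
      chartIncl σ u ∈ strictTransform S f := by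
    filter_upwards [(continuous_chartIncl σ).continuousAt.eventually
      ((isOpen_regularNeighborhood S f).mem_nhds hU)] with u hu
    exact and_iff_left hu
  by_cases hu₀ : ∀ P, u₀ P ≠ 0
  · exact (isSubmanifoldAt_of_ne_zero h.dim_ne_zero hV hU hu₀ hM).of_le le_top
  push Not at hu₀
  obtain ⟨P₀, hP₀⟩ := hu₀
  obtain ⟨τ, hτσ, hE⟩ := exists_finset_eq_zeroVertices u₀
  have hpos : ∀ P ∈ τ, StrictlyPositive P := fun P hP => by
    by_contra hPpos
    exact hU (subset_closure (Or.inl ⟨P, chartIncl_mem_divisor.2 (hE ▸ hP), hPpos⟩))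
  have hτ : τ.Nonempty := ⟨P₀.1, hE.subset ⟨P₀.2, hP₀⟩⟩
  obtain ⟨m₀, hm₀s, hm₀⟩ := exists_common_monomial
    (support_nonempty_of_isConvenient h.dim_ne_zero h.convenient) h.admissible
    (S.face_mem _ σ.2.1 _ hτσ)
  have hne := apply_ne_zero_of_notMem_coordsIn hE
  have h0 := chartQuotient_eq_zero_of_mem h hpos hm₀s hm₀ hne (chartIncl_mem_strictTransform.1 hV)
  have htr := isTransversal_chartQuotient h hτσ hτ hpos hm₀s hm₀ hE h0
  have hM' : ∀ᶠ u in 𝓝 u₀,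
      u ∈ chartIncl σ ⁻¹' (strictTransform S f ∩ regularNeighborhood S f) ↔
        chartQuotient f σ τ m₀ u = 0 := by
    filter_upwards [hM, eventually_mem_chartStrictTransform_iff h hτσ hτ hpos hm₀s hm₀ hE h0]
      with u hu hu'
    rw [hu, chartIncl_mem_strictTransform, hu']
  have hdim : 2 * Fintype.card {P : Fin n → ℕ // P ∈ σ.1} - 2 = 2 * (n - 1) := by
    rw [card_maxCone]; omega
  rw [← hdim]
  by_cases hr0 : r = 0
  · subst hr0
    exact htr.isSubmanifoldAt_zero hM'
  · refine htr.isSubmanifoldAt (ENat.one_le_iff_ne_zero_withTop.2 hr0) hr ?_ hM'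
    intro m hm P hP
    have hPτ := mem_coordsIn.1 hP
    by_cases hmP : radialExponent m ∈ face f (toReal P.1)
    · exact contDiff_mixedPow_of_eq_zero
        ((chartExponent_eq_zero_iff h hPτ hm₀s (hm₀ _ hPτ) hm).2 hmP)
    · exact hreg τ σ u₀ hτσ hpos hV hE hr0 _ ⟨P.1, hPτ, m, hm, hmP, rfl⟩ _ _
        (chartExponent_add hPτ (hm₀ _ hPτ))

theorem lambdaOfCone_mem_lambdaSet {n : ℕ} {f : MixedPoly n} {S : RegularSubdivision n}
    {τ : Finset (Fin n → ℕ)} {σ : S.MaxCone} {u : ChartSpace σ} (hτσ : τ ⊆ σ.1)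
    (hpos : ∀ P ∈ τ, StrictlyPositive P) (hV : chartIncl σ u ∈ strictTransform S f)
    (hE : zeroVertices u = (τ : Set (Fin n → ℕ))) (hne : (excessSet f τ).Nonempty) :
    lambdaOfCone f τ ∈ lambdaSet S f :=
  ⟨τ, S.face_mem _ σ.2.1 _ hτσ, hpos, hne, ⟨σ, hτσ, chartIncl σ u,
    ⟨hV, chartIncl_mem_divisorStratum.2 hE⟩, u, rfl⟩, rfl⟩

theorem isToricSubmanifold_lambda {n : ℕ} {f : MixedPoly n} {S : RegularSubdivision n}
    (h : IsAdmissiblePair f S) {Λ : ℕ} (hΛ : IsLeast (lambdaSet S f) (Λ : ℝ)) :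
    IsToricSubmanifold ((Λ - 1 : ℕ) : WithTop ℕ∞) (2 * (n - 1))
      (strictTransform S f ∩ regularNeighborhood S f) := by
  refine isToricSubmanifold_of_regularity h (by simp) ?_
  intro τ σ u hτσ hpos hV hE hr x hx a b hab
  have h1 := hΛ.2 (lambdaOfCone_mem_lambdaSet hτσ hpos hV hE ⟨x, hx⟩)
  have h2 := (isLeast_lambdaOfCone ⟨x, hx⟩).2 hx
  have h3 : (Λ : ℤ) ≤ a + b := by
    have : (Λ : ℝ) ≤ ((a + b : ℤ) : ℝ) := hab ▸ h1.trans h2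
    exact_mod_cast this
  have h4 : Λ - 1 ≠ 0 := fun h0 => hr (by rw [h0]; rfl)
  exact contDiff_mixedPow _ (by omega)

theorem isToricSubmanifold_analytic {n : ℕ} {f : MixedPoly n} {S : RegularSubdivision n}
    (h : IsAdmissiblePair f S) (hΛ : lambdaSet S f = ∅) :
    IsToricSubmanifold ω (2 * (n - 1)) (strictTransform S f ∩ regularNeighborhood S f) := by
  refine isToricSubmanifold_of_regularity h (by simp) ?_
  intro τ σ u hτσ hpos hV hE _ x hx
  exact absurd (lambdaOfCone_mem_lambdaSet hτσ hpos hV hE ⟨x, hx⟩) (by simp [hΛ])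

theorem isToricSubmanifold_diff_exceptionalSet {n : ℕ} {f : MixedPoly n}
    {S : RegularSubdivision n} (hn : n ≠ 0) :
    IsToricSubmanifold ω (2 * (n - 1))
      ((strictTransform S f ∩ regularNeighborhood S f) \ exceptionalSet S) := by
  rintro σ u₀ ⟨⟨hV, hU⟩, hexc⟩
  have hu₀ : ∀ P, u₀ P ≠ 0 := fun P hP => by
    have hpos : StrictlyPositive P.1 := by
      by_contra hPpos
      exact hU (subset_closure (Or.inl ⟨P.1, chartIncl_mem_divisor.2 ⟨P.2, hP⟩, hPpos⟩))
    exact hexc (chartIncl_mem_exceptionalSet.2 (chartProj_eq_zero hpos hP))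
  refine isSubmanifoldAt_of_ne_zero hn hV hU hu₀ ?_
  filter_upwards [(continuous_chartIncl σ).continuousAt.eventually
    ((isOpen_regularNeighborhood S f).mem_nhds hU),
    eventually_apply_ne_zero (p := fun _ => True) fun P _ => hu₀ P] with u hu hune
  refine ⟨fun h => h.1.1, fun h => ⟨⟨h, hu⟩, fun he => ?_⟩⟩
  exact chartProj_ne_zero hn (fun P => hune P trivial) (chartIncl_mem_exceptionalSet.1 he)

end MixedToric

theorem mainTheorem1 (n : ℕ) (hn : 2 ≤ n) (f : MixedPoly n) (hf0 : f.eval 0 = 0)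
    (hconv : IsConvenient f) (hnondeg : IsNewtonNondegenerate f)
    (hface : IsStronglyPolarNonnegFaceType f)
    (S : RegularSubdivision n) (hadm : S.IsAdmissible f) (hSconv : S.IsConvenientFor f) :
    (∀ τ ∈ S.cones, τ.Nonempty → (∀ P ∈ τ, StrictlyPositive P) →
      strictTransformStratum S f τ = ∅ ∨
        (τ.card + 1 ≤ n ∧
          IsToricSubmanifold ω (2 * (n - τ.card - 1)) (strictTransformStratum S f τ))) ∧
    (AssumptionStar S f →
      ∃ U : Set (ToricModification S), IsOpen U ∧ strictTransform S f ∩ exceptionalSet S ⊆ U ∧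
        ((lambdaSet S f).Nonempty → ∃ Λ : ℕ, 1 ≤ Λ ∧ IsLeast (lambdaSet S f) (Λ : ℝ) ∧
          IsToricSubmanifold ((Λ - 1 : ℕ) : WithTop ℕ∞) (2 * (n - 1)) (strictTransform S f ∩ U)) ∧
        (lambdaSet S f = ∅ →
          IsToricSubmanifold ω (2 * (n - 1)) (strictTransform S f ∩ U)) ∧
        IsToricSubmanifold 0 (2 * (n - 1)) (strictTransform S f ∩ U) ∧
        IsToricSubmanifold ω (2 * (n - 1)) ((strictTransform S f ∩ U) \ exceptionalSet S)) := by
  have hn0 : n ≠ 0 := by omega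
  have h : IsAdmissiblePair f S := ⟨hn0, hconv, hnondeg, hface, hadm⟩
  refine ⟨fun τ hτS hτ hpos => ?_, fun hstar => ⟨regularNeighborhood S f,
    isOpen_regularNeighborhood S f, strictTransform_inter_exceptionalSet_subset h hstar,
    fun hne => ?_, isToricSubmanifold_analytic h, ?_,
    isToricSubmanifold_diff_exceptionalSet hn0⟩⟩
  · rcases (strictTransformStratum S f τ).eq_empty_or_nonempty with hem | ⟨x, hx⟩
    · exact Or.inl hem
    · obtain ⟨σ, u, rfl⟩ := exists_eq_chartIncl x
      exact Or.inr ⟨(isSubmanifoldAt_strictTransformStratum h hτS hτ hpos hx).1,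
        fun σ u hu => (isSubmanifoldAt_strictTransformStratum h hτS hτ hpos hu).2⟩
  · obtain ⟨Λ, hΛ1, hΛ⟩ := exists_isLeast_lambdaSet hne
    exact ⟨Λ, hΛ1, hΛ, isToricSubmanifold_lambda h hΛ⟩
  · exact isToricSubmanifold_of_regularity h (by simp) fun _ _ _ _ _ _ _ hr => absurd rfl hr
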